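/- **Setting.** Let $n\ge 0$. Let $B,B^-\subset GL_n(\mathbb C)$ be the upper and lower triangular matrices, and $\mathrm{Fl}_n=GL_n/B$ the complete flag variety over $\mathbb C$. Identify $w\in S_n$ with the permutation matrix $e_j\mapsto e_{w(j)}$. Write $X^v=\overline{BvB}$, $X_u=\overline{B^-uB}$ (Zariski closures in $\mathrm{Fl}_n$) and $X^v_u=X^v\cap X_u$. *Sequences.* $\mathrm{RTSeq}_n$ is the set of words $\Omega=x_1\cdots x_n$ with letters $x_i\in\{\mathsf r_1,\mathsf t_1,\dots,\mathsf r_{i-1},\mathsf t_{i-1},\mathsf r_i\}$. For $w\in S_{m-1}$ and $1\le j\le m$ let $\epsilon_j(w)\in S_m$ be obtained by increasing all values of $w$ by $1$ and inserting the value $1$ at position $j$ of the one-line notation. Define $u(\Omega),v(\Omega)\in S_n$ recursively by $u(\emptyset)=v(\emptyset)=\mathrm{id}$ and $$(u,v)(\Omega'\mathsf r_j)=(\epsilon_j u(\Omega'),\epsilon_j v(\Omega')),\qquad (u,v)(\Omega'\mathsf t_j)=(\epsilon_j u(\Omega'),\epsilon_{j+1}v(\Omega')),$$ and put $X(\Omega)=X^{v(\Omega)}_{u(\Omega)}\subset\mathrm{Fl}_n$.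 *Nested forests.* A nested forest is a noncrossing partition $\pi$ of $\{1,2,\dots\}$ into finite blocks, all but finitely many of them singletons, together with a plane binary tree $T_A$ with $|A|$ leaves for each block $A\in\pi$; the leaves of $T_A$ are labelled from left to right by the elements of $A$ in increasing order. Let $\mathsf{NFor}_n$ be the set of nested forests in which every leaf $i>n$ forms a trivial (one-node) tree. To $\Omega\in\mathrm{RTSeq}_n$ associate the nested forest $\widehat F(\Omega)$ as follows: $\widehat F(\emptyset)$ has only trivial trees; $\widehat F(\Omega'\mathsf t_j)$ is obtained from $\widehat F(\Omega')$ by giving two children to the $j$-th leaf; $\widehat F(\Omega'\mathsf r_j)$ is obtained by inserting a new trivial tree between the leaves $j-1$ and $j$ (before the first leaf if $j=1$); in both cases the leaves are renumbered from left to right. For $\widehat F\in\mathsf{NFor}_n$ let $\mathrm{Trim}(\widehat F)=\{\Omega\in\mathrm{RTSeq}_n : \widehat F(\Omega)=\widehat F\}$. **Theorem.** Let $\widehat F\in \mathsf{NFor}_n$. Then: 1. $\mathrm{Trim}(\widehat F)$ is nonempty, and for all $\Omega,\Omega'\in\mathrm{Trim}(\widehat F)$ $$u(\Omega)^{-1}X(\Omega)=u(\Omega')^{-1}X(\Omega')\quad\text{as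 subsets of }\mathrm{Fl}_n .$$ 2. Consequently there is exactly one subset $X(\widehat F)\subset \mathrm{Fl}_n$ (the quasisymmetric Schubert cycle of $\widehat F$) with $X(\widehat F)=u(\Omega)^{-1}X(\Omega)$ for all $\Omega\in\mathrm{Trim}(\widehat F)$; it is Zariski closed. 3. For every $\Omega\in\mathrm{Trim}(\widehat F)$, left multiplication by $u(\Omega)^{-1}$ restricts to an isomorphism of algebraic varieties $X(\Omega)\cong X(\widehat F)$. -/

import Mathlib

open scoped MatrixGroups Pointwise

namespace QSymSchubert

/-! ### The complete flag variety `GL_n / B` over the complex numbers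

All indices are `0`-based: the index `i` of `{1, …, n}` is `i - 1 : Fin n` here. -/

/-- The Borel subgroup `B` of upper triangular matrices. -/
def borel (n : ℕ) : Subgroup (GL (Fin n) ℂ) where
  carrier := {g | (g : Matrix (Fin n) (Fin n) ℂ).BlockTriangular id}
  one_mem' := by
    simpa using Matrix.blockTriangular_one
  mul_mem' := by
    intro a b ha hb
    simpa using Matrix.BlockTriangular.mul ha hb
  inv_mem' := by
    intro a ha
    have : Invertible (a : Matrix (Fin n) (Fin n) ℂ) := a.invertible
    have h : (a : Matrix (Fin n) (Fin n) ℂ)⁻¹.BlockTriangular id :=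
      Matrix.blockTriangular_inv_of_blockTriangular ha
    simpa using h

theorem mem_borel {n : ℕ} (g : GL (Fin n) ℂ) : g ∈ borel n ↔ ∀ i j, j < i → g i j = 0 :=
  ⟨fun h _ _ hij => h hij, fun h i j hij => h i j hij⟩

/-- The opposite Borel subgroup `B⁻` of lower triangular matrices. -/
def oppBorel (n : ℕ) : Subgroup (GL (Fin n) ℂ) where
  carrier := {g | (g : Matrix (Fin n) (Fin n) ℂ).BlockTriangular OrderDual.toDual}
  one_mem' := by
    simpa using Matrix.blockTriangular_one
  mul_mem' := by
    intro a b ha hb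
    simpa using Matrix.BlockTriangular.mul ha hb
  inv_mem' := by
    intro a ha
    have : Invertible (a : Matrix (Fin n) (Fin n) ℂ) := a.invertible
    have h : (a : Matrix (Fin n) (Fin n) ℂ)⁻¹.BlockTriangular OrderDual.toDual :=
      Matrix.blockTriangular_inv_of_blockTriangular ha
    simpa using h

theorem mem_oppBorel {n : ℕ} (g : GL (Fin n) ℂ) :
    g ∈ oppBorel n ↔ ∀ i j, i < j → g i j = 0 :=
  ⟨fun h _ _ hij => h (OrderDual.toDual_lt_toDual.2 hij),
    fun h i j hij => h i j (OrderDual.toDual_lt_toDual.1 hij)⟩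

/-- The complete flag variety `Fl_n = GL_n / B` (its set of complex points). The coset of `g` is the
flag whose `j`-th space is spanned by the first `j` columns of `g`. -/
def FlagVar (n : ℕ) : Type := GL (Fin n) ℂ ⧸ borel n

/-- The projection `GL_n → GL_n / B`. -/
def FlagVar.mk {n : ℕ} (g : GL (Fin n) ℂ) : FlagVar n := QuotientGroup.mk g

/-- `GL_n` acts on `GL_n / B` by left multiplication. -/
instance (n : ℕ) : MulAction (GL (Fin n) ℂ) (FlagVar n) :=
  inferInstanceAs (MulAction (GL (Fin n) ℂ) (GL (Fin n) ℂ ⧸ borel n))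

theorem FlagVar.smul_mk {n : ℕ} (g h : GL (Fin n) ℂ) :
    g • FlagVar.mk h = FlagVar.mk (g * h) := rfl

/-! ### Zariski topology and regular functions -/

/-- The value at `g` of a polynomial in the matrix entries. -/
noncomputable def polyEval {n : ℕ} (g : GL (Fin n) ℂ) (p : MvPolynomial (Fin n × Fin n) ℂ) : ℂ :=
  MvPolynomial.eval (fun ij : Fin n × Fin n => g ij.1 ij.2) p

/-- The Zariski topology of `GL_n`: the topology with the nonvanishing sets of polynomials in the
matrix entries as a basis (these sets are stable under finite intersections). -/
abbrev zariskiGL (n : ℕ) : TopologicalSpace (GL (Fin n) ℂ) :=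
  TopologicalSpace.generateFrom
    {U | ∃ p : MvPolynomial (Fin n × Fin n) ℂ, U = {g | polyEval g p ≠ 0}}

/-- The Zariski topology of `Fl_n`: the quotient of the Zariski topology of `GL_n`. -/
instance (n : ℕ) : TopologicalSpace (FlagVar n) :=
  TopologicalSpace.coinduced FlagVar.mk (zariskiGL n)

/-- `f` is a regular function on the (open) subset `W` of `GL_n`: locally it is a quotient of
polynomials in the matrix entries. -/
def RegularOnGL {n : ℕ} (W : Set (GL (Fin n) ℂ)) (f : GL (Fin n) ℂ → ℂ) : Prop :=
  ∀ g ∈ W, ∃ p q : MvPolynomial (Fin n × Fin n) ℂ, polyEval g q ≠ 0 ∧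
    ∀ h ∈ W, polyEval h q ≠ 0 → f h = polyEval h p / polyEval h q

/-- `f` is a regular function on the open subset `U` of `Fl_n = GL_n / B`: its pullback to `GL_n`
is regular on the preimage of `U`. -/
def RegularOnFlag {n : ℕ} (U : Set (FlagVar n)) (f : FlagVar n → ℂ) : Prop :=
  RegularOnGL (FlagVar.mk ⁻¹' U) (f ∘ FlagVar.mk)

/-- `f` is a regular function on the open subset `V` of the closed subvariety `Z` of `Fl_n`
(with its reduced structure): locally it extends to a regular function on an open subset
of `Fl_n`. -/
def RegularOnSub {n : ℕ} {Z : Set (FlagVar n)} (V : Set Z) (f : Z → ℂ) : Prop :=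
  ∀ z ∈ V, ∃ U : Set (FlagVar n), IsOpen U ∧ (z : FlagVar n) ∈ U ∧
    ∃ F : FlagVar n → ℂ, RegularOnFlag U F ∧
      ∀ y : Z, y ∈ V → (y : FlagVar n) ∈ U → f y = F y

/-- A bijection between closed subvarieties of `Fl_n` is an isomorphism of algebraic varieties if
it is a homeomorphism for the Zariski topologies which identifies the regular functions. -/
def IsVarietyIso {n : ℕ} {Z Z' : Set (FlagVar n)} (e : Z ≃ Z') : Prop :=
  Continuous e ∧ Continuous e.symm ∧
    ∀ (V : Set Z') (f : Z' → ℂ), IsOpen V →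
      (RegularOnSub V f ↔ RegularOnSub (e ⁻¹' V) (f ∘ e))

/-! ### Schubert, opposite Schubert and Richardson varieties -/

/-- The permutation matrix of `w`, with `e_j ↦ e_{w(j)}`. -/
def permGL {n : ℕ} (w : Equiv.Perm (Fin n)) : GL (Fin n) ℂ where
  val := w⁻¹.permMatrix ℂ
  inv := w.permMatrix ℂ
  val_inv := by rw [← Matrix.permMatrix_mul]; simp
  inv_val := by rw [← Matrix.permMatrix_mul]; simp

theorem permGL_apply {n : ℕ} (w : Equiv.Perm (Fin n)) (i j : Fin n) :
    permGL w i j = if i = w j then 1 else 0 := by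
  change (w⁻¹.permMatrix ℂ) i j = _
  simp [Equiv.Perm.permMatrix, PEquiv.toMatrix_apply, Equiv.eq_symm_apply, eq_comm]

/-- The Schubert variety `X^v`, the Zariski closure of `B v B` in `GL_n / B`. -/
def schubert {n : ℕ} (v : Equiv.Perm (Fin n)) : Set (FlagVar n) :=
  closure {x | ∃ b ∈ borel n, x = b • FlagVar.mk (permGL v)}

/-- The opposite Schubert variety `X_u`, the Zariski closure of `B⁻ u B` in `GL_n / B`. -/
def oppSchubert {n : ℕ} (u : Equiv.Perm (Fin n)) : Set (FlagVar n) :=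
  closure {x | ∃ b ∈ oppBorel n, x = b • FlagVar.mk (permGL u)}

/-- The Richardson variety `X^v_u`. -/
def richardson {n : ℕ} (u v : Equiv.Perm (Fin n)) : Set (FlagVar n) :=
  schubert v ∩ oppSchubert u

/-! ### The sequences in `RTSeq_n` and their Richardson varieties -/

/-- `RTSeq n` is the set of words `x_1 x_2 ⋯ x_n` with
`x_i ∈ {r_1, t_1, r_2, t_2, …, r_{i-1}, t_{i-1}, r_i}`. A word of length `n + 1` is a word `Ω` of
length `n` followed by a letter `r_{j+1}` with `j < n + 1`, or by a letter `t_{j+1}`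
with `j < n`. -/
inductive RTSeq : ℕ → Type
  | nil : RTSeq 0
  | r {n : ℕ} (Ω : RTSeq n) (j : Fin (n + 1)) : RTSeq (n + 1)
  | t {n : ℕ} (Ω : RTSeq n) (j : Fin n) : RTSeq (n + 1)

/-- Insert the smallest value at position `i` of the one-line notation of `w`, all other values
being increased by one. -/
def ins {n : ℕ} (i : Fin (n + 1)) (w : Equiv.Perm (Fin n)) : Equiv.Perm (Fin (n + 1)) :=
  (finSuccEquiv' i).trans ((Equiv.optionCongr w).trans (finSuccEquiv' 0).symm)

theorem ins_self {n : ℕ} (i : Fin (n + 1)) (w : Equiv.Perm (Fin n)) : ins i w i = 0 := by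
  simp [ins]

theorem ins_succAbove {n : ℕ} (i : Fin (n + 1)) (w : Equiv.Perm (Fin n)) (k : Fin n) :
    ins i w (i.succAbove k) = (w k).succ := by
  simp [ins]

/-- The permutation `u(Ω)`. -/
def RTSeq.u : {n : ℕ} → RTSeq n → Equiv.Perm (Fin n)
  | _, .nil => 1
  | _, .r Ω j => ins j Ω.u
  | _, .t Ω j => ins j.castSucc Ω.u

/-- The permutation `v(Ω)`. -/
def RTSeq.v : {n : ℕ} → RTSeq n → Equiv.Perm (Fin n)
  | _, .nil => 1
  | _, .r Ω j => ins j Ω.v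
  | _, .t Ω j => ins j.succ Ω.v

/-- The `Ω`-Richardson variety `X(Ω) = X^{v(Ω)}_{u(Ω)}`. -/
def RTSeq.X {n : ℕ} (Ω : RTSeq n) : Set (FlagVar n) := richardson Ω.u Ω.v

/-! ### Nested forests -/

/-- Plane binary trees with leaves labelled by natural numbers. -/
inductive LTree : Type
  | leaf (i : ℕ) : LTree
  | node (l r : LTree) : LTree

namespace LTree

/-- The labels of the leaves, from left to right. -/
def leaves : LTree → List ℕ
  | leaf i => [i]
  | node l r => l.leaves ++ r.leaves

/-- Replace every leaf `k` by the tree `f k`. -/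
def subst (f : ℕ → LTree) : LTree → LTree
  | leaf k => f k
  | node l r => node (l.subst f) (r.subst f)

/-- Give two children `i`, `i + 1` to the leaf `i`; the leaves to its right are renumbered. -/
def split (i : ℕ) : LTree → LTree :=
  subst fun k => if k < i then leaf k
    else if k = i then node (leaf i) (leaf (i + 1)) else leaf (k + 1)

/-- Renumber the leaves to make room for a new leaf `i`. -/
def shift (i : ℕ) : LTree → LTree :=
  subst fun k => if k < i then leaf k else leaf (k + 1)

theorem leaves_subst (f : ℕ → LTree) (T : LTree) :
    (T.subst f).leaves = T.leaves.flatMap fun k => (f k).leaves := by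
  induction T with
  | leaf k => simp [subst, leaves]
  | node l r hl hr => simp [subst, leaves, hl, hr]

theorem mem_leaves_split (i k : ℕ) (T : LTree) :
    k ∈ (T.split i).leaves ↔ (if k ≤ i then k else k - 1) ∈ T.leaves := by
  simp only [split, leaves_subst, List.mem_flatMap]
  constructor
  · rintro ⟨m, hm, hk⟩
    have h : (if k ≤ i then k else k - 1) = m := by
      split_ifs at hk <;> simp [leaves] at hk <;> grind
    rwa [h]
  · intro h
    refine ⟨_, h, ?_⟩
    grind [leaves]

theorem mem_leaves_shift (i k : ℕ) (T : LTree) :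
    k ∈ (T.shift i).leaves ↔ k ≠ i ∧ (if k ≤ i then k else k - 1) ∈ T.leaves := by
  simp only [shift, leaves_subst, List.mem_flatMap]
  constructor
  · rintro ⟨m, hm, hk⟩
    have h : k ≠ i ∧ (if k ≤ i then k else k - 1) = m := by
      split_ifs at hk <;> simp [leaves] at hk <;> grind
    exact ⟨h.1, h.2 ▸ hm⟩
  · rintro ⟨hne, h⟩
    refine ⟨_, h, ?_⟩
    grind [leaves]

theorem pairwise_split (i : ℕ) (T : LTree) (h : T.leaves.Pairwise (· < ·)) :
    (T.split i).leaves.Pairwise (· < ·) := by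
  simp only [split, leaves_subst, List.pairwise_flatMap]
  refine ⟨fun k _ => ?_, h.imp ?_⟩
  · split_ifs <;> simp [leaves]
  · intro a b hab x hx y hy
    split_ifs at hx hy <;> simp [leaves] at hx hy <;> omega

theorem pairwise_shift (i : ℕ) (T : LTree) (h : T.leaves.Pairwise (· < ·)) :
    (T.shift i).leaves.Pairwise (· < ·) := by
  simp only [shift, leaves_subst, List.pairwise_flatMap]
  refine ⟨fun k _ => ?_, h.imp ?_⟩
  · split_ifs <;> simp [leaves]
  · intro a b hab x hx y hy
    split_ifs at hx hy <;> simp [leaves] at hx hy <;> omega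

end LTree

/-- A (plane, binary) nested forest: a noncrossing partition of `ℕ` into finite blocks, all but
finitely many of them singletons, with a plane binary tree with `|B|` leaves for every block `B`.
The leaves of the tree of `B` are labelled from left to right by the elements of `B` in increasing
order, so that the blocks are the sets of leaf labels of the trees. -/
@[ext]
structure NestedForest : Type where
  trees : Set LTree
  sorted : ∀ T ∈ trees, T.leaves.Pairwise (· < ·)
  partition : ∀ i : ℕ, ∃! T, T ∈ trees ∧ i ∈ T.leaves
  noncrossing : ∀ T ∈ trees, ∀ T' ∈ trees, T ≠ T' →
    ∀ a ∈ T.leaves, ∀ b ∈ T.leaves, ∀ c ∈ T'.leaves, ∀ d ∈ T'.leaves, ¬ (a < c ∧ c < b ∧ b < d)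
  finite : ∃ N : ℕ, ∀ i, N ≤ i → LTree.leaf i ∈ trees

namespace NestedForest

/-- The forest all of whose trees are trivial. -/
def empty : NestedForest where
  trees := Set.range LTree.leaf
  sorted := by
    rintro _ ⟨i, rfl⟩
    simp [LTree.leaves]
  partition := by
    intro i
    refine ⟨LTree.leaf i, ⟨⟨i, rfl⟩, by simp [LTree.leaves]⟩, ?_⟩
    rintro _ ⟨⟨j, rfl⟩, hj⟩
    simp [LTree.leaves] at hj
    rw [hj]
  noncrossing := by
    rintro _ ⟨i, rfl⟩ _ ⟨j, rfl⟩ _ a ha b hb c hc d hd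
    simp [LTree.leaves] at ha hb hc hd
    omega
  finite := ⟨0, fun i _ => ⟨i, rfl⟩⟩

theorem eq_of_mem (F : NestedForest) {T T' : LTree} (hT : T ∈ F.trees) (hT' : T' ∈ F.trees)
    {i : ℕ} (h : i ∈ T.leaves) (h' : i ∈ T'.leaves) : T = T' :=
  (F.partition i).unique ⟨hT, h⟩ ⟨hT', h'⟩

/-- The forest `F · i`: the leaf `i` of `F` is given two children. -/
def split (F : NestedForest) (i : ℕ) : NestedForest where
  trees := LTree.split i '' F.trees
  sorted := by
    rintro _ ⟨T, hT, rfl⟩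
    exact LTree.pairwise_split i T (F.sorted T hT)
  partition := by
    intro k
    obtain ⟨T, ⟨hT, hk⟩, hu⟩ := F.partition (if k ≤ i then k else k - 1)
    refine ⟨T.split i, ⟨⟨T, hT, rfl⟩, (LTree.mem_leaves_split i k T).2 hk⟩, ?_⟩
    rintro _ ⟨⟨T', hT', rfl⟩, hk'⟩
    rw [hu T' ⟨hT', (LTree.mem_leaves_split i k T').1 hk'⟩]
  noncrossing := by
    rintro _ ⟨T, hT, rfl⟩ _ ⟨T', hT', rfl⟩ hne a ha b hb c hc d hd ⟨hac, hcb, hbd⟩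
    rw [LTree.mem_leaves_split] at ha hb hc hd
    have hTT : T ≠ T' := fun h => hne (by rw [h])
    have key : ∀ x ∈ T.leaves, ∀ y ∈ T'.leaves, x ≠ y := fun x hx y hy hxy =>
      hTT (F.eq_of_mem hT hT' hx (hxy ▸ hy))
    have h1 := key _ ha _ hc
    have h2 := key _ hb _ hc
    have h3 := key _ hb _ hd
    refine F.noncrossing T hT T' hT' hTT _ ha _ hb _ hc _ hd ?_
    grind
  finite := by
    obtain ⟨N, hN⟩ := F.finite
    refine ⟨max N i + 2, fun k hk => ⟨LTree.leaf (k - 1), hN _ (by omega), ?_⟩⟩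
    have h1 : ¬ k - 1 < i := by omega
    have h2 : k - 1 ≠ i := by omega
    have h3 : k - 1 + 1 = k := by omega
    simp [LTree.split, LTree.subst, h1, h2, h3]

/-- The forest obtained from `F` by inserting a trivial tree between the leaves `i - 1` and `i`
(before the first leaf if `i = 0`). -/
def insertLeaf (F : NestedForest) (i : ℕ) : NestedForest where
  trees := insert (LTree.leaf i) (LTree.shift i '' F.trees)
  sorted := by
    rintro _ (rfl | ⟨T, hT, rfl⟩)
    · simp [LTree.leaves]
    · exact LTree.pairwise_shift i T (F.sorted T hT)
  partition := by
    intro k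
    by_cases hki : k = i
    · subst hki
      refine ⟨LTree.leaf k, ⟨Or.inl rfl, by simp [LTree.leaves]⟩, ?_⟩
      rintro _ ⟨rfl | ⟨T, hT, rfl⟩, hk⟩
      · rfl
      · exact absurd rfl ((LTree.mem_leaves_shift k k T).1 hk).1
    · obtain ⟨T, ⟨hT, hk⟩, hu⟩ := F.partition (if k ≤ i then k else k - 1)
      refine ⟨T.shift i, ⟨Or.inr ⟨T, hT, rfl⟩, (LTree.mem_leaves_shift i k T).2 ⟨hki, hk⟩⟩, ?_⟩
      rintro _ ⟨rfl | ⟨T', hT', rfl⟩, hk'⟩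
      · simp [LTree.leaves] at hk'
        exact absurd hk' hki
      · rw [hu T' ⟨hT', ((LTree.mem_leaves_shift i k T').1 hk').2⟩]
  noncrossing := by
    rintro _ (rfl | ⟨T, hT, rfl⟩) _ (rfl | ⟨T', hT', rfl⟩) hne a ha b hb c hc d hd ⟨hac, hcb, hbd⟩
    · exact hne rfl
    · simp [LTree.leaves] at ha hb
      omega
    · simp [LTree.leaves] at hc hd
      omega
    · rw [LTree.mem_leaves_shift] at ha hb hc hd
      have hTT : T ≠ T' := fun h => hne (by rw [h])
      refine F.noncrossing T hT T' hT' hTT _ ha.2 _ hb.2 _ hc.2 _ hd.2 ?_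
      grind
  finite := by
    obtain ⟨N, hN⟩ := F.finite
    refine ⟨max N i + 2, fun k hk => Or.inr ⟨LTree.leaf (k - 1), hN _ (by omega), ?_⟩⟩
    have h1 : ¬ k - 1 < i := by omega
    have h3 : k - 1 + 1 = k := by omega
    simp [LTree.shift, LTree.subst, h1, h3]

/-- `F` belongs to `NFor_n`: the leaves from the `(n+1)`-st on belong to trivial trees. -/
def SupportedOn (F : NestedForest) (n : ℕ) : Prop := ∀ i, n ≤ i → LTree.leaf i ∈ F.trees

end NestedForest

/-- The nested forest of a sequence, `F(∅) = ∅`, `F(Ω t_j) = F(Ω) · j` and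
`F(Ω r_j) = F(Ω) · j_∘`. -/
def RTSeq.forest : {n : ℕ} → RTSeq n → NestedForest
  | _, .nil => .empty
  | _, .r Ω j => Ω.forest.insertLeaf j
  | _, .t Ω j => Ω.forest.split j

/-- The set `Trim(F)` of the sequences in `RTSeq_n` which trim the nested forest `F`. -/
def Trim (n : ℕ) (F : NestedForest) : Set (RTSeq n) := {Ω | Ω.forest = F}

end QSymSchubert

open QSymSchubert

/-!
The preimage of the translate `u(Ω)⁻¹ X(Ω)` in `GL_n` (`RTSeq.translate`) satisfies a recursion in
which `u(Ω)` and `v(Ω)` no longer occur. Let `κ_j : GL_n → GL_{n+1}` be the block embedding which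
fixes the coordinate `j`, and let `P_j` be the minimal parabolic subgroup of the columns `j` and
`j + 1`. Then the sequence `Ω r_j` has the translate `κ_j(S) B`, and `Ω t_j` has the translate
`κ_j(S) P_j`, where `S` is the translate of `Ω` (`RTSeq.translate_r`, `RTSeq.translate_t`).

The recursion holds for the following reasons. If `v j = 0`, the closure of `B v B` consists of
flags whose `(j + 1)`-dimensional space contains `e_0` (`inv_apply_zero_of_mem`); if `u j = 0`, the
closure of `B⁻ u B` consists of flags whose `j`-dimensional space is contained in the span of the
other basis vectors (`apply_zero_of_mem`). A flag with both properties is obtained from a smaller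
flag by inserting `e_0` (`exists_mul_eq_insGL`), and insertion and removal of `e_0` are polynomial
maps which respect the double cosets, hence also their closures (`insGL_mem_doubleCosetClosure`,
`mem_doubleCosetClosure_borel_of_insGL`, `mem_doubleCosetClosure_oppBorel_of_insGL`). No explicit
description of the Bruhat order is needed. For a letter `t_j` the positions of the value `0` in `u`
and `v` are `j` and `j + 1`, so both closures are stable under `P_j`
(`mul_parab_mem_doubleCosetClosure`), and `P_j` moves every flag in the intersection to one of the
previous kind.

The extension steps of two letters commute, up to the shift of their indices, whenever their blocks
of columns are disjoint (`extend_extend_eq`). On the side of forests, if a forest arises from two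
different last letters, then it has two disjoint trivial trees or cherries with consecutive leaves,
and both can be removed. The forest which remains comes from some sequence (`trim_nonempty`): in a
forest without trivial trees, a tree of minimal width has consecutive leaves because the forest is
noncrossing, so it contains a cherry with consecutive leaves. Induction on `n` now shows that the
translate only depends on the forest (`RTSeq.translateEq`). Finally, left translations are
homeomorphisms of the flag variety which pull back regular functions to regular functions
(`isVarietyIso_of_smul`).
-/

namespace QSymSchubert

/-! ### Block embeddings of general linear groups -/

/-- The `0`-`1` matrix of `f`, with `e_a ↦ e_{f a}`. -/
def incl {m n : ℕ} (f : Fin m → Fin n) : Matrix (Fin n) (Fin m) ℂ :=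
  Matrix.of fun i a => if i = f a then 1 else 0

theorem incl_apply {m n : ℕ} (f : Fin m → Fin n) (i : Fin n) (a : Fin m) :
    incl f i a = if i = f a then 1 else 0 := rfl

theorem incl_mul_incl {l m n : ℕ} (f : Fin m → Fin n) (g : Fin l → Fin m) :
    incl f * incl g = incl (f ∘ g) := by
  ext i a
  simp [Matrix.mul_apply, incl_apply]

theorem transpose_incl_mul_self {m n : ℕ} (f : Fin m ↪ Fin n) : (incl f).transpose * incl f = 1 := by
  ext a b
  simp [Matrix.mul_apply, incl_apply, Matrix.one_apply, eq_comm]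

theorem transpose_incl_mul_of_disjoint {l m n : ℕ} {f : Fin m → Fin n} {g : Fin l → Fin n}
    (h : ∀ a b, f a ≠ g b) : (incl f).transpose * incl g = 0 := by
  ext a b
  simpa [Matrix.mul_apply, incl_apply] using (h a b).symm

theorem mul_incl_apply {l m n : ℕ} (f : Fin m → Fin n) (A : Matrix (Fin l) (Fin n) ℂ)
    (i : Fin l) (a : Fin m) : (A * incl f) i a = A i (f a) := by
  simp [Matrix.mul_apply, incl_apply]

theorem transpose_incl_mul_apply {l m n : ℕ} (f : Fin m → Fin n) (A : Matrix (Fin n) (Fin l) ℂ)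
    (a : Fin m) (i : Fin l) : ((incl f).transpose * A) a i = A (f a) i := by
  simp [Matrix.mul_apply, incl_apply]

/-- The block matrix which is `A` on the image of `f` and the identity on the complement. -/
def kapMat {m n : ℕ} (f : Fin m ↪ Fin n) (A : Matrix (Fin m) (Fin m) ℂ) :
    Matrix (Fin n) (Fin n) ℂ :=
  incl f * A * (incl f).transpose + (1 - incl f * (incl f).transpose)

theorem kapMat_mul {m n : ℕ} (f : Fin m ↪ Fin n) (A B : Matrix (Fin m) (Fin m) ℂ) :
    kapMat f (A * B) = kapMat f A * kapMat f B := by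
  have h := transpose_incl_mul_self f
  have h1 : ∀ C : Matrix (Fin m) (Fin n) ℂ, (incl f).transpose * (incl f * C) = C := by
    intro C; rw [← Matrix.mul_assoc, h, Matrix.one_mul]
  simp only [kapMat, Matrix.mul_add, Matrix.add_mul, Matrix.mul_sub, Matrix.sub_mul,
    Matrix.mul_assoc, h1, Matrix.mul_one, Matrix.one_mul]
  abel

/-- The embedding `GL_m → GL_n` along an injection `f` of the index sets: `A` acts on the
coordinates in the image of `f`, the other coordinates are fixed. -/
def kap {m n : ℕ} (f : Fin m ↪ Fin n) : GL (Fin m) ℂ →* GL (Fin n) ℂ :=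
  Units.map
    { toFun := kapMat f
      map_one' := by simp [kapMat]
      map_mul' := kapMat_mul f }

theorem coe_kap {m n : ℕ} (f : Fin m ↪ Fin n) (A : GL (Fin m) ℂ) :
    (kap f A : Matrix (Fin n) (Fin n) ℂ) = kapMat f A := rfl

theorem kap_apply_apply {m n : ℕ} (f : Fin m ↪ Fin n) (A : GL (Fin m) ℂ) (a b : Fin m) :
    kap f A (f a) (f b) = A a b := by
  simp [coe_kap, kapMat, Matrix.mul_apply, incl_apply, Matrix.one_apply]

theorem kap_apply_left {m n : ℕ} (f : Fin m ↪ Fin n) (A : GL (Fin m) ℂ) {i : Fin n}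
    (hi : ∀ a, f a ≠ i) (k : Fin n) : kap f A i k = if i = k then 1 else 0 := by
  have hi' : ∀ a, i ≠ f a := fun a h => hi a h.symm
  simp [coe_kap, kapMat, Matrix.mul_apply, incl_apply, Matrix.one_apply, hi']

theorem kap_apply_right {m n : ℕ} (f : Fin m ↪ Fin n) (A : GL (Fin m) ℂ) {k : Fin n}
    (hk : ∀ a, f a ≠ k) (i : Fin n) : kap f A i k = if i = k then 1 else 0 := by
  have hk' : ∀ a, k ≠ f a := fun a h => hk a h.symm
  simp [coe_kap, kapMat, Matrix.mul_apply, incl_apply, Matrix.one_apply, hk']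

theorem kap_kap {l m n : ℕ} (f : Fin m ↪ Fin n) (g : Fin l ↪ Fin m) (A : GL (Fin l) ℂ) :
    kap f (kap g A) = kap (g.trans f) A := by
  ext1
  have h : incl (g.trans f) = incl f * incl g := by rw [incl_mul_incl]; rfl
  simp only [coe_kap, kapMat, h, Matrix.transpose_mul, Matrix.mul_add, Matrix.add_mul,
    Matrix.mul_sub, Matrix.sub_mul, Matrix.mul_assoc, Matrix.mul_one]
  abel

theorem kap_commute {l m n : ℕ} (f : Fin m ↪ Fin n) (g : Fin l ↪ Fin n) (h : ∀ a b, f a ≠ g b)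
    (A : GL (Fin m) ℂ) (C : GL (Fin l) ℂ) : kap f A * kap g C = kap g C * kap f A := by
  have h1 : ∀ D : Matrix (Fin l) (Fin n) ℂ, (incl f).transpose * (incl g * D) = 0 := by
    intro D
    rw [← Matrix.mul_assoc, transpose_incl_mul_of_disjoint h, Matrix.zero_mul]
  have h2 : ∀ D : Matrix (Fin m) (Fin n) ℂ, (incl g).transpose * (incl f * D) = 0 := by
    intro D
    rw [← Matrix.mul_assoc, transpose_incl_mul_of_disjoint fun a b => (h b a).symm,
      Matrix.zero_mul]
  ext1
  simp only [Units.val_mul, coe_kap, kapMat, Matrix.mul_add, Matrix.add_mul, Matrix.mul_sub,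
    Matrix.sub_mul, Matrix.mul_assoc, Matrix.mul_one, Matrix.one_mul, h1, h2, Matrix.mul_zero]
  abel

theorem coe_permGL {n : ℕ} (w : Equiv.Perm (Fin n)) :
    (permGL w : Matrix (Fin n) (Fin n) ℂ) = incl w := by
  ext i j
  exact permGL_apply w i j

theorem permGL_mul {n : ℕ} (v w : Equiv.Perm (Fin n)) : permGL (v * w) = permGL v * permGL w := by
  ext1
  rw [Units.val_mul, coe_permGL, coe_permGL, coe_permGL, incl_mul_incl]
  rfl

theorem permGL_one {n : ℕ} : permGL (1 : Equiv.Perm (Fin n)) = 1 := by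
  ext i j
  rw [permGL_apply, Units.val_one, Matrix.one_apply]
  rfl

theorem permGL_inv {n : ℕ} (w : Equiv.Perm (Fin n)) : permGL w⁻¹ = (permGL w)⁻¹ := by
  rw [eq_inv_iff_mul_eq_one, ← permGL_mul, inv_mul_cancel, permGL_one]

/-- Conjugating a block embedding by a permutation matrix moves the block. -/
theorem permGL_mul_kap {m n : ℕ} (w : Equiv.Perm (Fin n)) (f : Fin m ↪ Fin n) (A : GL (Fin m) ℂ) :
    permGL w * kap f A = kap (f.trans w.toEmbedding) A * permGL w := by
  have hw : (incl w).transpose * incl w = 1 := transpose_incl_mul_self w.toEmbedding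
  have h : incl (f.trans w.toEmbedding) = incl w * incl f := by rw [incl_mul_incl]; rfl
  ext1
  simp only [Units.val_mul, coe_kap, kapMat, coe_permGL, h, Matrix.transpose_mul, Matrix.mul_add,
    Matrix.add_mul, Matrix.mul_sub, Matrix.sub_mul, Matrix.mul_assoc, hw, Matrix.mul_one,
    Matrix.one_mul]

/-! ### Minimal parabolic subgroups -/

theorem kap_apply_eq_zero {m n : ℕ} {f : Fin m ↪ Fin n} {A : GL (Fin m) ℂ} {i k : Fin n}
    (hik : i ≠ k) (h : ∀ a b, f a = i → f b = k → A a b = 0) : kap f A i k = 0 := by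
  by_cases hi : ∃ a, f a = i
  · by_cases hk : ∃ b, f b = k
    · obtain ⟨a, ha⟩ := hi
      obtain ⟨b, hb⟩ := hk
      rw [← h a b ha hb, ← ha, ← hb, kap_apply_apply]
    · rw [kap_apply_right f A (not_exists.1 hk), if_neg hik]
  · rw [kap_apply_left f A (not_exists.1 hi), if_neg hik]

theorem kap_mem_borel {m n : ℕ} {f : Fin m ↪ Fin n} {A : GL (Fin m) ℂ}
    (h : ∀ a b, f b < f a → A a b = 0) : kap f A ∈ borel n :=
  (mem_borel _).2 fun _ _ hik => kap_apply_eq_zero hik.ne' fun a b ha hb => h a b (ha ▸ hb ▸ hik)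

theorem kap_mem_oppBorel {m n : ℕ} {f : Fin m ↪ Fin n} {A : GL (Fin m) ℂ}
    (h : ∀ a b, f a < f b → A a b = 0) : kap f A ∈ oppBorel n :=
  (mem_oppBorel _).2 fun _ _ hik => kap_apply_eq_zero hik.ne fun a b ha hb => h a b (ha ▸ hb ▸ hik)

/-- The minimal parabolic subgroup of the block upper triangular matrices with a single block of
size two, in the rows and columns `j` and `j + 1`. -/
def parab {n : ℕ} (j : Fin n) : Subgroup (GL (Fin (n + 1)) ℂ) where
  carrier := {g | (g : Matrix (Fin (n + 1)) (Fin (n + 1)) ℂ).BlockTriangular j.predAbove}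
  one_mem' := by
    simpa using Matrix.blockTriangular_one
  mul_mem' := by
    intro a b ha hb
    simpa using Matrix.BlockTriangular.mul ha hb
  inv_mem' := by
    intro a ha
    have : Invertible (a : Matrix (Fin (n + 1)) (Fin (n + 1)) ℂ) := a.invertible
    have h : (a : Matrix (Fin (n + 1)) (Fin (n + 1)) ℂ)⁻¹.BlockTriangular j.predAbove :=
      Matrix.blockTriangular_inv_of_blockTriangular ha
    simpa using h

theorem predAbove_lt_predAbove_iff {n : ℕ} (j : Fin n) (k l : Fin (n + 1)) :
    j.predAbove l < j.predAbove k ↔ l < k ∧ ¬ (k = j.succ ∧ l = j.castSucc) := by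
  have key : ∀ k : Fin (n + 1), (j.predAbove k).val = if j.val < k.val then k.val - 1 else k.val := by
    intro k
    by_cases h : j.val < k.val
    · rw [Fin.predAbove_of_castSucc_lt _ _ h, if_pos h, Fin.val_pred]
    · rw [Fin.predAbove_of_le_castSucc _ _ (Fin.le_def.2 (not_lt.1 h)), if_neg h, Fin.coe_castPred]
  simp only [Fin.lt_def, key, Fin.ext_iff, Fin.val_succ, Fin.val_castSucc]
  split_ifs <;> omega

theorem mem_parab {n : ℕ} {j : Fin n} {g : GL (Fin (n + 1)) ℂ} :
    g ∈ parab j ↔ ∀ k l, l < k → ¬ (k = j.succ ∧ l = j.castSucc) → g k l = 0 :=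
  ⟨fun h _ _ hlk hne => h ((predAbove_lt_predAbove_iff j _ _).2 ⟨hlk, hne⟩),
    fun h _ _ hlk => h _ _ ((predAbove_lt_predAbove_iff j _ _).1 hlk).1
      ((predAbove_lt_predAbove_iff j _ _).1 hlk).2⟩

theorem borel_le_parab {n : ℕ} (j : Fin n) : borel (n + 1) ≤ parab j := by
  intro g hg
  rw [mem_parab]
  intro k l hlk _
  exact (mem_borel g).1 hg k l hlk

/-- The inclusion of the two consecutive indices `j` and `j + 1`. -/
def pair {n : ℕ} (j : Fin n) : Fin 2 ↪ Fin (n + 1) where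
  toFun := ![j.castSucc, j.succ]
  inj' := by
    intro a b
    fin_cases a <;> fin_cases b <;> simp [Fin.ext_iff]

@[simp] theorem pair_zero {n : ℕ} (j : Fin n) : pair j 0 = j.castSucc := rfl

@[simp] theorem pair_one {n : ℕ} (j : Fin n) : pair j 1 = j.succ := rfl

theorem kap_pair_mem_parab {n : ℕ} (j : Fin n) (A : GL (Fin 2) ℂ) : kap (pair j) A ∈ parab j := by
  rw [mem_parab]
  intro k l hlk hne
  refine kap_apply_eq_zero hlk.ne' ?_
  rintro a b rfl rfl
  fin_cases a <;> fin_cases b <;> simp [Fin.lt_def] at hlk hne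

/-- Entries of products in the block of a parabolic subgroup only involve that block. -/
theorem sum_pair_of_mem_parab {n : ℕ} {j : Fin n} {p q : GL (Fin (n + 1)) ℂ} (hp : p ∈ parab j)
    (hq : q ∈ parab j) (a b : Fin 2) :
    ∑ c, p (pair j a) (pair j c) * q (pair j c) (pair j b) = (p * q) (pair j a) (pair j b) := by
  rw [Units.val_mul, Matrix.mul_apply]
  refine Fintype.sum_of_injective (pair j) (pair j).injective _ _ ?_ fun _ => rfl
  intro l hl
  have h0 : l ≠ j.castSucc := fun h => hl ⟨0, h.symm⟩
  have h1 : l ≠ j.succ := fun h => hl ⟨1, h.symm⟩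
  rcases lt_or_gt_of_ne h0 with h | h
  · rw [mem_parab.1 hp _ l, zero_mul]
    · fin_cases a <;> simp [Fin.lt_def] at h ⊢ <;> omega
    · exact fun h' => h0 h'.2
  · rw [mem_parab.1 hq l, mul_zero]
    · have h1' : l.val ≠ j.val + 1 := fun h' => h1 (Fin.ext h')
      fin_cases b <;> simp [Fin.lt_def] at h ⊢ <;> omega
    · exact fun h' => h1 h'.1

theorem exists_kap_pair_mul_of_mem_parab {n : ℕ} {j : Fin n} {p : GL (Fin (n + 1)) ℂ}
    (hp : p ∈ parab j) : ∃ A : GL (Fin 2) ℂ, ∃ b ∈ borel (n + 1), p = kap (pair j) A * b := by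
  let A : GL (Fin 2) ℂ :=
    { val := Matrix.of fun a b => p (pair j a) (pair j b)
      inv := Matrix.of fun a b => p⁻¹ (pair j a) (pair j b)
      val_inv := by
        ext a b
        rw [Matrix.mul_apply]
        refine (sum_pair_of_mem_parab hp (inv_mem hp) a b).trans ?_
        simp [Matrix.one_apply]
      inv_val := by
        ext a b
        rw [Matrix.mul_apply]
        refine (sum_pair_of_mem_parab (inv_mem hp) hp a b).trans ?_
        simp [Matrix.one_apply] }
  have hA : ∀ a b, A a b = p (pair j a) (pair j b) := fun _ _ => rfl
  refine ⟨A, kap (pair j) A⁻¹ * p, ?_, by rw [← mul_assoc, ← map_mul]; simp⟩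
  have hm : kap (pair j) A⁻¹ * p ∈ parab j := mul_mem (kap_pair_mem_parab j _) hp
  rw [mem_borel]
  intro k l hlk
  by_cases hne : k = j.succ ∧ l = j.castSucc
  · obtain ⟨rfl, rfl⟩ := hne
    have h := sum_pair_of_mem_parab (kap_pair_mem_parab j A⁻¹) hp 1 0
    simp only [kap_apply_apply, ← hA] at h
    rw [← Matrix.mul_apply, ← Units.val_mul, inv_mul_cancel] at h
    exact h.symm
  · exact mem_parab.1 hm k l hlk hne

/-- `Q` is a subgroup containing `B`, and every element of `Q` is the product of an invertible
matrix in the block given by `f` and an element of `B`. -/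
structure IsBlockExt {k n : ℕ} (f : Fin k ↪ Fin n) (Q : Subgroup (GL (Fin n) ℂ)) : Prop where
  borel_le : borel n ≤ Q
  kap_mem : ∀ A, kap f A ∈ Q
  exists_eq : ∀ q ∈ Q, ∃ A : GL (Fin k) ℂ, ∃ b ∈ borel n, q = kap f A * b

theorem isBlockExt_parab {n : ℕ} (j : Fin n) : IsBlockExt (pair j) (parab j) :=
  ⟨borel_le_parab j, kap_pair_mem_parab j, fun _ => exists_kap_pair_mul_of_mem_parab⟩

theorem isBlockExt_borel {n : ℕ} (f : Fin 0 ↪ Fin n) : IsBlockExt f (borel n) :=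
  ⟨le_rfl, fun _ => kap_mem_borel fun a => a.elim0, fun q hq => ⟨1, q, hq, by simp⟩⟩

/-- The increasing injection of the indices which omits `i`; the block embedding along it fixes the
coordinate `i`. -/
abbrev above {n : ℕ} (i : Fin (n + 1)) : Fin n ↪ Fin (n + 1) := i.succAboveEmb

/-- The elements `κ(s) q` with `s ∈ S` and `q ∈ Q`, for the block embedding `κ` which fixes the
coordinate `i`. -/
def extend {n : ℕ} (i : Fin (n + 1)) (Q : Subgroup (GL (Fin (n + 1)) ℂ)) (S : Set (GL (Fin n) ℂ)) :
    Set (GL (Fin (n + 1)) ℂ) :=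
  {g | ∃ s ∈ S, ∃ q ∈ Q, g = kap (above i) s * q}

theorem kap_above_mem_borel {n : ℕ} (i : Fin (n + 1)) {b : GL (Fin n) ℂ} (hb : b ∈ borel n) :
    kap (above i) b ∈ borel (n + 1) :=
  kap_mem_borel fun a c h => (mem_borel b).1 hb a c (i.strictMono_succAbove.lt_iff_lt.1 h)

/-- Two extensions whose blocks are disjoint can be exchanged. Both sides consist of the products
`κ(s) a c b` with `s ∈ S`, `b ∈ B`, and `a`, `c` in the two blocks. -/
theorem extend_extend_subset {n k l : ℕ} {i j : Fin (n + 2)} {i' j' : Fin (n + 1)}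
    {f : Fin k ↪ Fin (n + 1)} {g : Fin l ↪ Fin (n + 1)}
    {P Q : Subgroup (GL (Fin (n + 2)) ℂ)} {P' Q' : Subgroup (GL (Fin (n + 1)) ℂ)}
    (hP' : IsBlockExt f P') (hQ' : IsBlockExt g Q')
    (hP : IsBlockExt (f.trans (above j)) P) (hQ : IsBlockExt (g.trans (above i)) Q)
    (hfg : ∀ a b, above j (f a) ≠ above i (g b))
    (hij : (above j').trans (above i) = (above i').trans (above j)) (S : Set (GL (Fin n) ℂ)) :
    extend i P (extend j' Q' S) ⊆ extend j Q (extend i' P' S) := by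
  rintro _ ⟨_, ⟨s, hs, q', hq', rfl⟩, p, hp, rfl⟩
  obtain ⟨C, c, hc, rfl⟩ := hQ'.exists_eq q' hq'
  obtain ⟨A, b, hb, hA⟩ := hP.exists_eq (kap (above i) c * p)
    (mul_mem (hP.borel_le (kap_above_mem_borel i hc)) hp)
  refine ⟨kap (above i') s * kap f A, ⟨s, hs, _, hP'.kap_mem A, rfl⟩,
    kap (g.trans (above i)) C * b, mul_mem (hQ.kap_mem C) (hQ.borel_le hb), ?_⟩
  calc kap (above i) (kap (above j') s * (kap g C * c)) * p
      = kap ((above i').trans (above j)) s * kap (g.trans (above i)) C *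
          (kap (above i) c * p) := by
        simp only [map_mul, kap_kap, hij, mul_assoc]
    _ = kap ((above i').trans (above j)) s *
          (kap (f.trans (above j)) A * kap (g.trans (above i)) C) * b := by
        rw [hA, kap_commute (f.trans (above j)) (g.trans (above i)) hfg]
        simp only [mul_assoc]
    _ = _ := by simp only [map_mul, kap_kap, mul_assoc]

theorem extend_extend_eq {n k l : ℕ} {i j : Fin (n + 2)} {i' j' : Fin (n + 1)}
    {f : Fin k ↪ Fin (n + 1)} {g : Fin l ↪ Fin (n + 1)}
    {P Q : Subgroup (GL (Fin (n + 2)) ℂ)} {P' Q' : Subgroup (GL (Fin (n + 1)) ℂ)}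
    (hP' : IsBlockExt f P') (hQ' : IsBlockExt g Q')
    (hP : IsBlockExt (f.trans (above j)) P) (hQ : IsBlockExt (g.trans (above i)) Q)
    (hfg : ∀ a b, above j (f a) ≠ above i (g b))
    (hij : (above j').trans (above i) = (above i').trans (above j)) (S : Set (GL (Fin n) ℂ)) :
    extend i P (extend j' Q' S) = extend j Q (extend i' P' S) :=
  (extend_extend_subset hP' hQ' hP hQ hfg hij S).antisymm
    (extend_extend_subset hQ' hP' hQ hP (fun a b => (hfg b a).symm) hij.symm S)

/-! ### Zariski closures in the general linear group -/

/-- The Zariski closure of a set of invertible matrices: the common zeros in `GL_n` of the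
polynomials in the matrix entries which vanish on the set. -/
def zcl {n : ℕ} (S : Set (GL (Fin n) ℂ)) : Set (GL (Fin n) ℂ) :=
  {g | ∀ p, (∀ s ∈ S, polyEval s p = 0) → polyEval g p = 0}

theorem subset_zcl {n : ℕ} (S : Set (GL (Fin n) ℂ)) : S ⊆ zcl S := fun _ hs _ hp => hp _ hs

theorem zcl_mono {n : ℕ} {S T : Set (GL (Fin n) ℂ)} (h : S ⊆ T) : zcl S ⊆ zcl T :=
  fun _ hg p hp => hg p fun s hs => hp s (h hs)

theorem zcl_subset_zcl {n : ℕ} {S T : Set (GL (Fin n) ℂ)} (h : S ⊆ zcl T) : zcl S ⊆ zcl T :=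
  fun _ hg p hp => hg p fun _ hs => h hs p hp

/-- Evaluation at `g` of a polynomial in the matrix entries, as a ring homomorphism. -/
noncomputable def evalAt {n : ℕ} (g : GL (Fin n) ℂ) :
    MvPolynomial (Fin n × Fin n) ℂ →+* ℂ :=
  MvPolynomial.eval fun ij : Fin n × Fin n => g ij.1 ij.2

theorem polyEval_eq {n : ℕ} (g : GL (Fin n) ℂ) (p : MvPolynomial (Fin n × Fin n) ℂ) :
    polyEval g p = evalAt g p := rfl

theorem map_C_evalAt {k l n : ℕ} (g : GL (Fin n) ℂ) (A : Matrix (Fin k) (Fin l) ℂ) :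
    (A.map MvPolynomial.C).map (evalAt g) = A := by
  ext i j
  simp [evalAt]

theorem mvPolynomialX_map_evalAt {n : ℕ} (g : GL (Fin n) ℂ) :
    (Matrix.mvPolynomialX (Fin n) (Fin n) ℂ).map (evalAt g) = g := by
  ext i j
  simp [evalAt]

theorem polyEval_bind₁ {m n : ℕ} {φ : Matrix (Fin m) (Fin m) (MvPolynomial (Fin n × Fin n) ℂ)}
    {g : GL (Fin n) ℂ} {g' : GL (Fin m) ℂ}
    (h : (g' : Matrix (Fin m) (Fin m) ℂ) = φ.map (evalAt g)) (p : MvPolynomial (Fin m × Fin m) ℂ) :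
    polyEval g (MvPolynomial.bind₁ (fun ij => φ ij.1 ij.2) p) = polyEval g' p := by
  have h' : (fun ij : Fin m × Fin m => g' ij.1 ij.2) = fun ij => evalAt g (φ ij.1 ij.2) := by
    funext ij
    rw [h, Matrix.map_apply]
  unfold polyEval
  rw [h']
  simp only [evalAt, MvPolynomial.eval, MvPolynomial.eval₂Hom_bind₁]

/-- Polynomial maps are continuous for the Zariski topology. It suffices that the values of the map
are invertible on the set and at the point of interest. -/
theorem mem_zcl_of_polynomialMap {m n : ℕ}
    (φ : Matrix (Fin m) (Fin m) (MvPolynomial (Fin n × Fin n) ℂ))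
    {S : Set (GL (Fin n) ℂ)} {S' : Set (GL (Fin m) ℂ)}
    (hS : ∀ h ∈ S, ∃ s ∈ zcl S', (s : Matrix (Fin m) (Fin m) ℂ) = φ.map (evalAt h))
    {g : GL (Fin n) ℂ} (hg : g ∈ zcl S) {g' : GL (Fin m) ℂ}
    (hg' : (g' : Matrix (Fin m) (Fin m) ℂ) = φ.map (evalAt g)) : g' ∈ zcl S' := by
  intro p hp
  rw [← polyEval_bind₁ hg']
  refine hg _ fun h hh => ?_
  obtain ⟨s, hs, hsφ⟩ := hS h hh
  rw [polyEval_bind₁ hsφ]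
  exact hs p hp

theorem mem_zcl_of_affineMap {m n : ℕ} (A : Matrix (Fin m) (Fin n) ℂ) (A' : Matrix (Fin n) (Fin m) ℂ)
    (C : Matrix (Fin m) (Fin m) ℂ) {S : Set (GL (Fin n) ℂ)} {S' : Set (GL (Fin m) ℂ)}
    (hS : ∀ h ∈ S, ∃ s ∈ zcl S', s.val = A * h.val * A' + C)
    {g : GL (Fin n) ℂ} (hg : g ∈ zcl S) {g' : GL (Fin m) ℂ}
    (hg' : g'.val = A * g.val * A' + C) : g' ∈ zcl S' := by
  let R := MvPolynomial (Fin n × Fin n) ℂ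
  let φ : Matrix (Fin m) (Fin m) R :=
    (A.map MvPolynomial.C : Matrix (Fin m) (Fin n) R) * Matrix.mvPolynomialX (Fin n) (Fin n) ℂ *
      (A'.map MvPolynomial.C : Matrix (Fin n) (Fin m) R) +
      (C.map MvPolynomial.C : Matrix (Fin m) (Fin m) R)
  have key : ∀ h : GL (Fin n) ℂ, φ.map (evalAt h) = A * h.val * A' + C := by
    intro h
    rw [Matrix.map_add _ (map_add _), Matrix.map_mul, Matrix.map_mul, map_C_evalAt, map_C_evalAt,
      map_C_evalAt, mvPolynomialX_map_evalAt]
  refine mem_zcl_of_polynomialMap φ (fun h hh => ?_) hg (hg'.trans (key g).symm)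
  obtain ⟨s, hs, he⟩ := hS h hh
  exact ⟨s, hs, he.trans (key h).symm⟩

theorem mul_mul_mem_zcl {n : ℕ} {S S' : Set (GL (Fin n) ℂ)} (a b : GL (Fin n) ℂ)
    (hS : ∀ h ∈ S, a * h * b ∈ zcl S') {g : GL (Fin n) ℂ} (hg : g ∈ zcl S) :
    a * g * b ∈ zcl S' :=
  mem_zcl_of_affineMap a.val b.val 0 (fun h hh => ⟨_, hS h hh, by simp⟩) hg (by simp)

/-- The closure of the double coset `H w B`. -/
def doubleCosetClosure {n : ℕ} (H : Subgroup (GL (Fin n) ℂ)) (w : Equiv.Perm (Fin n)) :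
    Set (GL (Fin n) ℂ) :=
  zcl {g | ∃ h ∈ H, ∃ b ∈ borel n, g = h * permGL w * b}

section DoubleCosetClosure

variable {n : ℕ} {H : Subgroup (GL (Fin n) ℂ)} {w : Equiv.Perm (Fin n)}

theorem mul_mem_doubleCosetClosure {h g b : GL (Fin n) ℂ} (hh : h ∈ H) (hb : b ∈ borel n)
    (hg : g ∈ doubleCosetClosure H w) : h * g * b ∈ doubleCosetClosure H w := by
  refine mul_mul_mem_zcl h b ?_ hg
  rintro _ ⟨h', hh', b', hb', rfl⟩
  exact subset_zcl _ ⟨h * h', mul_mem hh hh', b' * b, mul_mem hb' hb, by simp only [mul_assoc]⟩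

theorem mul_borel_mem_doubleCosetClosure {g b : GL (Fin n) ℂ} (hb : b ∈ borel n)
    (hg : g ∈ doubleCosetClosure H w) : g * b ∈ doubleCosetClosure H w := by
  simpa using mul_mem_doubleCosetClosure (one_mem H) hb hg

end DoubleCosetClosure

/-- The matrices with a nonzero corner entry are dense in `GL_2`. -/
theorem mem_zcl_corner_ne_zero (A : GL (Fin 2) ℂ) : A ∈ zcl {A : GL (Fin 2) ℂ | A 0 0 ≠ 0} := by
  intro p hp
  -- `p * X₀₀ * det` vanishes at every matrix, so it is the zero polynomial.
  have h0 : p * MvPolynomial.X (0, 0) * (Matrix.mvPolynomialX (Fin 2) (Fin 2) ℂ).det = 0 := by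
    refine MvPolynomial.funext fun x => ?_
    have hx : MvPolynomial.eval x (Matrix.mvPolynomialX (Fin 2) (Fin 2) ℂ).det =
        (Matrix.of fun i j => x (i, j)).det := by
      rw [RingHom.map_det]
      congr 1
      ext i j
      simp
    rw [map_mul, map_mul, hx, MvPolynomial.eval_X, map_zero]
    by_cases hd : (Matrix.of fun i j => x (i, j)).det = 0
    · rw [hd, mul_zero]
    by_cases hc : x (0, 0) = 0
    · rw [hc, mul_zero, zero_mul]
    · have := hp (Matrix.GeneralLinearGroup.mkOfDetNeZero _ hd) hc
      have h2 : MvPolynomial.eval x p = 0 := this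
      rw [h2, zero_mul, zero_mul]
  have hp0 : p = 0 := by
    rcases mul_eq_zero.1 h0 with h | h
    · exact (mul_eq_zero.1 h).resolve_right (MvPolynomial.X_ne_zero _)
    · exact absurd h (Matrix.det_mvPolynomialX_ne_zero _ _)
  rw [hp0, polyEval_eq, map_zero]

/-- If the lower unipotent matrices of the block `j`, `j + 1` are conjugated by `w` into `H`, then
the closure of `H w B` is stable under the minimal parabolic subgroup of this block: the flags
`w p B` with `p` in the parabolic subgroup form a projective line, all of whose points but one are
in `H w B`. -/
theorem mul_parab_mem_doubleCosetClosure {n : ℕ} {H : Subgroup (GL (Fin (n + 1)) ℂ)}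
    {w : Equiv.Perm (Fin (n + 1))} {j : Fin n}
    (hw : ∀ A : GL (Fin 2) ℂ, A 0 1 = 0 → kap ((pair j).trans w.toEmbedding) A ∈ H)
    {g p : GL (Fin (n + 1)) ℂ} (hg : g ∈ doubleCosetClosure H w) (hp : p ∈ parab j) :
    g * p ∈ doubleCosetClosure H w := by
  have hA : ∀ A : GL (Fin 2) ℂ, permGL w * kap (pair j) A ∈ doubleCosetClosure H w := by
    intro A
    refine mem_zcl_of_affineMap (incl w * incl (pair j)) (incl (pair j)).transpose
      (incl w * (1 - incl (pair j) * (incl (pair j)).transpose)) (fun A hA => ?_)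
      (mem_zcl_corner_ne_zero A) ?_
    · refine ⟨permGL w * kap (pair j) A, ?_, ?_⟩
      · -- The `LU` factorization of a matrix with a nonzero corner entry.
        let U : GL (Fin 2) ℂ := Matrix.GeneralLinearGroup.mkOfDetNeZero
          !![A 0 0, A 0 1; 0, A 1 1 - A 1 0 / A 0 0 * A 0 1] (by
            have hd : A.val.det ≠ 0 := A.isUnit.map Matrix.detMonoidHom |>.ne_zero
            rw [Matrix.det_fin_two] at hd
            have hA' : A 0 0 ≠ 0 := hA
            rw [Matrix.det_fin_two_of]
            convert hd using 1
            field_simp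
            ring)
        let V : GL (Fin 2) ℂ := Matrix.GeneralLinearGroup.mkOfDetNeZero
          !![1, 0; A 1 0 / A 0 0, 1] (by simp [Matrix.det_fin_two_of])
        have hVU : A = V * U := by
          have hA' : A 0 0 ≠ 0 := hA
          ext a b
          change A a b = (!![1, 0; A 1 0 / A 0 0, 1] *
            !![A 0 0, A 0 1; 0, A 1 1 - A 1 0 / A 0 0 * A 0 1] : Matrix _ _ ℂ) a b
          fin_cases a <;> fin_cases b <;> simp [Matrix.mul_apply, Fin.sum_univ_two]
          field_simp
        refine subset_zcl _ ⟨kap ((pair j).trans w.toEmbedding) V, hw V rfl, kap (pair j) U,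
          kap_mem_borel fun a b hab => ?_, ?_⟩
        · fin_cases a <;> fin_cases b <;> simp [Fin.lt_def] at hab
          rfl
        · rw [← permGL_mul_kap, mul_assoc, ← map_mul, ← hVU]
      · simp only [Units.val_mul, coe_permGL, coe_kap, kapMat, Matrix.mul_add, Matrix.mul_assoc]
    · simp only [Units.val_mul, coe_permGL, coe_kap, kapMat, Matrix.mul_add, Matrix.mul_assoc]
  have key : 1 * g * p ∈ doubleCosetClosure H w := by
    refine mul_mul_mem_zcl 1 p ?_ hg
    rintro _ ⟨h, hh, b, hb, rfl⟩
    obtain ⟨A, b', hb', hbp⟩ := exists_kap_pair_mul_of_mem_parab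
      (mul_mem (borel_le_parab j hb) hp)
    have h1 : 1 * (h * permGL w * b) * p = h * (permGL w * kap (pair j) A) * b' := by
      simp only [one_mul, mul_assoc, hbp]
    rw [h1]
    exact mul_mem_doubleCosetClosure hh hb' (hA A)
  rwa [one_mul] at key

/-! ### Schubert varieties and closures of double cosets -/

theorem isOpen_zariskiGL_iff {n : ℕ} {U : Set (GL (Fin n) ℂ)} :
    @IsOpen _ (zariskiGL n) U ↔
      ∀ g ∈ U, ∃ p, polyEval g p ≠ 0 ∧ ∀ h, polyEval h p ≠ 0 → h ∈ U := by
  constructor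
  · intro hU
    induction hU with
    | basic s hs =>
      obtain ⟨p, rfl⟩ := hs
      exact fun g hg => ⟨p, hg, fun h hh => hh⟩
    | univ => exact fun g _ => ⟨1, by simp [polyEval], fun h _ => trivial⟩
    | inter s t _ _ ihs iht =>
      intro g hg
      obtain ⟨p, hp, hps⟩ := ihs g hg.1
      obtain ⟨q, hq, hqt⟩ := iht g hg.2
      have hm : ∀ h : GL (Fin n) ℂ, polyEval h (p * q) = polyEval h p * polyEval h q :=
        fun h => map_mul _ _ _
      refine ⟨p * q, by rw [hm]; exact mul_ne_zero hp hq, fun h hh => ?_⟩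
      rw [hm] at hh
      exact ⟨hps h (left_ne_zero_of_mul hh), hqt h (right_ne_zero_of_mul hh)⟩
    | sUnion S _ ih =>
      rintro g ⟨s, hs, hg⟩
      obtain ⟨p, hp, hps⟩ := ih s hs g hg
      exact ⟨p, hp, fun h hh => ⟨s, hs, hps h hh⟩⟩
  · intro h
    choose! p hp hpU using h
    have : U = ⋃₀ ((fun g => {h | polyEval h (p g) ≠ 0}) '' U) := by
      ext g
      constructor
      · exact fun hg => ⟨_, ⟨g, hg, rfl⟩, hp g hg⟩
      · rintro ⟨_, ⟨g', hg', rfl⟩, hg⟩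
        exact hpU g' hg' g hg
    rw [this]
    refine TopologicalSpace.GenerateOpen.sUnion _ ?_
    rintro _ ⟨g, _, rfl⟩
    exact TopologicalSpace.GenerateOpen.basic _ ⟨p g, rfl⟩

theorem FlagVar.isOpen_iff {n : ℕ} {U : Set (FlagVar n)} :
    IsOpen U ↔ ∀ g, FlagVar.mk g ∈ U →
      ∃ p, polyEval g p ≠ 0 ∧ ∀ h, polyEval h p ≠ 0 → FlagVar.mk h ∈ U :=
  isOpen_zariskiGL_iff (U := FlagVar.mk ⁻¹' U)

theorem FlagVar.isClosed_iff {n : ℕ} {Z : Set (FlagVar n)} :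
    IsClosed Z ↔ ∀ g ∈ zcl (FlagVar.mk ⁻¹' Z), FlagVar.mk g ∈ Z := by
  rw [← isOpen_compl_iff, FlagVar.isOpen_iff]
  constructor
  · intro h g hg
    by_contra hgZ
    obtain ⟨p, hp, hpZ⟩ := h g hgZ
    refine hp (hg p fun s hs => ?_)
    by_contra hsp
    exact hpZ s hsp hs
  · intro h g hg
    by_contra! hc
    refine hg (h g fun p hp => ?_)
    by_contra hgp
    obtain ⟨s, hs, hsZ⟩ := hc p hgp
    exact hs (hp s (not_not.1 hsZ))

theorem FlagVar.mk_eq_mk_iff {n : ℕ} {g h : GL (Fin n) ℂ} :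
    FlagVar.mk g = FlagVar.mk h ↔ ∃ b ∈ borel n, h = g * b := by
  refine QuotientGroup.eq.trans ⟨fun hb => ⟨_, hb, by simp⟩, ?_⟩
  rintro ⟨b, hb, rfl⟩
  simpa using hb

theorem FlagVar.mk_surjective {n : ℕ} : Function.Surjective (FlagVar.mk (n := n)) :=
  QuotientGroup.mk_surjective

theorem mk_mem_closure_orbit_iff {n : ℕ} (H : Subgroup (GL (Fin n) ℂ)) (w : Equiv.Perm (Fin n))
    (g : GL (Fin n) ℂ) :
    FlagVar.mk g ∈ closure {x | ∃ b ∈ H, x = b • FlagVar.mk (permGL w)} ↔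
      g ∈ doubleCosetClosure H w := by
  have hpre : FlagVar.mk ⁻¹' {x | ∃ b ∈ H, x = b • FlagVar.mk (permGL w)} =
      {g | ∃ h ∈ H, ∃ b ∈ borel n, g = h * permGL w * b} := by
    ext g
    simp only [Set.mem_preimage, Set.mem_ofPred_eq, FlagVar.smul_mk]
    refine exists_congr fun h => and_congr_right fun _ => ?_
    rw [eq_comm, FlagVar.mk_eq_mk_iff]
  have hmk : FlagVar.mk ⁻¹' (FlagVar.mk '' doubleCosetClosure H w) = doubleCosetClosure H w := by
    refine Set.Subset.antisymm ?_ (Set.subset_preimage_image _ _)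
    rintro g ⟨g', hg', hgg⟩
    obtain ⟨b, hb, rfl⟩ := FlagVar.mk_eq_mk_iff.1 hgg
    exact mul_borel_mem_doubleCosetClosure hb hg'
  constructor
  · intro hg
    have hcl : IsClosed (FlagVar.mk '' doubleCosetClosure H w) := by
      rw [FlagVar.isClosed_iff, hmk]
      exact fun g hg => ⟨g, zcl_subset_zcl subset_rfl hg, rfl⟩
    have hsub := closure_minimal (s := {x | ∃ b ∈ H, x = b • FlagVar.mk (permGL w)}) ?_ hcl
    · rw [← hmk]
      exact hsub hg
    · intro x hx
      obtain ⟨g, rfl⟩ := FlagVar.mk_surjective x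
      refine ⟨g, ?_, rfl⟩
      rw [doubleCosetClosure, ← hpre]
      exact subset_zcl _ hx
  · intro hg
    refine FlagVar.isClosed_iff.1 isClosed_closure g ?_
    rw [doubleCosetClosure, ← hpre] at hg
    exact zcl_mono (Set.preimage_mono subset_closure) hg

theorem mk_mem_richardson_iff {n : ℕ} {u v : Equiv.Perm (Fin n)} {g : GL (Fin n) ℂ} :
    FlagVar.mk g ∈ richardson u v ↔
      g ∈ doubleCosetClosure (borel n) v ∧ g ∈ doubleCosetClosure (oppBorel n) u :=
  and_congr (mk_mem_closure_orbit_iff _ _ _) (mk_mem_closure_orbit_iff _ _ _)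

/-! ### Inserting a fixed direction into a flag -/

theorem kap_mul_apply {m n l : ℕ} (f : Fin m ↪ Fin n) (A : GL (Fin m) ℂ)
    (M : Matrix (Fin n) (Fin l) ℂ) (a : Fin m) (k : Fin l) :
    ((kap f A).val * M) (f a) k = ∑ c, A a c * M (f c) k := by
  rw [Matrix.mul_apply]
  symm
  refine Fintype.sum_of_injective f f.injective _ _ (fun i hi => ?_) fun c => ?_
  · have hi' : ∀ c, f c ≠ i := fun c h => hi ⟨c, h⟩
    rw [kap_apply_right f A hi', if_neg (hi' a), zero_mul]
  · rw [kap_apply_apply]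

theorem kap_mul_apply_of_forall_ne {m n l : ℕ} (f : Fin m ↪ Fin n) (A : GL (Fin m) ℂ)
    (M : Matrix (Fin n) (Fin l) ℂ) {i : Fin n} (hi : ∀ a, f a ≠ i) (k : Fin l) :
    ((kap f A).val * M) i k = M i k := by
  simp [Matrix.mul_apply, kap_apply_left f A hi]

theorem mul_kap_apply_of_forall_ne {m n l : ℕ} (f : Fin m ↪ Fin n) (A : GL (Fin m) ℂ)
    (M : Matrix (Fin l) (Fin n) ℂ) {k : Fin n} (hk : ∀ a, f a ≠ k) (i : Fin l) :
    (M * (kap f A).val) i k = M i k := by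
  simp [Matrix.mul_apply, kap_apply_right f A hk]

theorem permGL_mul_apply {n l : ℕ} (w : Equiv.Perm (Fin n)) (M : Matrix (Fin n) (Fin l) ℂ)
    (i : Fin n) (k : Fin l) : ((permGL w).val * M) i k = M (w.symm i) k := by
  have h : ∀ x, permGL w i x = if w.symm i = x then 1 else 0 := fun x => by
    rw [permGL_apply]
    exact if_congr (Equiv.symm_apply_eq w).symm rfl rfl
  simp [Matrix.mul_apply, h]

theorem ins_symm_zero {n : ℕ} (j : Fin (n + 1)) (w : Equiv.Perm (Fin n)) :
    (ins j w).symm 0 = j := by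
  rw [Equiv.symm_apply_eq, ins_self]

theorem ins_symm_succ {n : ℕ} (j : Fin (n + 1)) (w : Equiv.Perm (Fin n)) (d : Fin n) :
    (ins j w).symm d.succ = j.succAbove (w.symm d) := by
  rw [Equiv.symm_apply_eq, ins_succAbove, Equiv.apply_symm_apply]

/-- The matrix obtained from `g` by inserting the vector `e_0` as the column `j`, the rows of `g`
being moved down by one. -/
def insGL {n : ℕ} (j : Fin (n + 1)) (g : GL (Fin n) ℂ) : GL (Fin (n + 1)) ℂ :=
  permGL (ins j 1) * kap (above j) g

theorem insGL_mul {n : ℕ} (j : Fin (n + 1)) (g h : GL (Fin n) ℂ) :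
    insGL j (g * h) = insGL j g * kap (above j) h := by
  rw [insGL, map_mul, ← mul_assoc, insGL]

theorem insGL_mul' {n : ℕ} (j : Fin (n + 1)) (g h : GL (Fin n) ℂ) :
    insGL j (g * h) = kap (Fin.succEmb n) g * insGL j h := by
  have hf : (above j).trans (ins j 1).toEmbedding = Fin.succEmb n := by
    ext a
    simp [ins_succAbove]
  rw [insGL, map_mul, ← mul_assoc, permGL_mul_kap, hf, mul_assoc, insGL]

theorem insGL_permGL {n : ℕ} (j : Fin (n + 1)) (w : Equiv.Perm (Fin n)) :
    insGL j (permGL w) = permGL (ins j w) := by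
  ext i k
  rw [insGL, Units.val_mul, permGL_mul_apply, permGL_apply]
  refine Fin.cases ?_ (fun d => ?_) i
  · rw [ins_symm_zero, kap_apply_left _ _ (Fin.succAbove_ne j)]
    congr 1
    rw [← Equiv.symm_apply_eq, ins_symm_zero]
  · rw [ins_symm_succ]
    rcases Fin.eq_self_or_eq_succAbove j k with rfl | ⟨c, rfl⟩
    · rw [kap_apply_right _ _ (Fin.succAbove_ne k), ins_self]
      simp [Fin.succAbove_ne]
    · rw [ins_succAbove]
      refine (kap_apply_apply (above j) _ _ _).trans ?_
      simp only [permGL_apply, Fin.succ_inj]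
      rfl

theorem insGL_succ_succAbove {n : ℕ} (j : Fin (n + 1)) (g : GL (Fin n) ℂ) (a c : Fin n) :
    insGL j g a.succ (j.succAbove c) = g a c := by
  rw [insGL, Units.val_mul, permGL_mul_apply, ins_symm_succ]
  exact kap_apply_apply (above j) g a c

theorem insGL_self {n : ℕ} (j : Fin (n + 1)) (g : GL (Fin n) ℂ) (i : Fin (n + 1)) :
    insGL j g i j = if i = 0 then 1 else 0 := by
  rw [insGL, Units.val_mul, permGL_mul_apply, kap_apply_right _ _ (Fin.succAbove_ne j)]
  congr 1
  rw [Equiv.symm_apply_eq, ins_self]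

/-- Inserting `e_0` at position `j` maps `H w B` to `H' (ins j w) B`, since conjugation by the
inserted permutation turns the embedding along `j.succAbove` into the one along `Fin.succ`. -/
theorem insGL_mem_doubleCosetClosure {n : ℕ} {H : Subgroup (GL (Fin n) ℂ)}
    {H' : Subgroup (GL (Fin (n + 1)) ℂ)} (hH : ∀ h ∈ H, kap (Fin.succEmb n) h ∈ H')
    (j : Fin (n + 1)) {w : Equiv.Perm (Fin n)} {g : GL (Fin n) ℂ}
    (hg : g ∈ doubleCosetClosure H w) : insGL j g ∈ doubleCosetClosure H' (ins j w) := by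
  refine mem_zcl_of_affineMap (incl (ins j 1) * incl (above j)) (incl (above j)).transpose
    (incl (ins j 1) * (1 - incl (above j) * (incl (above j)).transpose)) ?_ hg ?_
  · rintro _ ⟨h, hh, b, hb, rfl⟩
    refine ⟨insGL j (h * permGL w * b), subset_zcl _ ⟨_, hH h hh, _, kap_above_mem_borel j hb, ?_⟩,
      ?_⟩
    · rw [insGL_mul, insGL_mul', insGL_permGL]
    · simp only [insGL, Units.val_mul, coe_permGL, coe_kap, kapMat, Matrix.mul_add,
        Matrix.mul_assoc]
  · simp only [insGL, Units.val_mul, coe_permGL, coe_kap, kapMat, Matrix.mul_add, Matrix.mul_assoc]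

/-! ### Triangular matrices -/

theorem borel_apply_self_ne_zero {n : ℕ} {b : GL (Fin n) ℂ} (hb : b ∈ borel n) (i : Fin n) :
    b i i ≠ 0 := by
  have hd : b.val.det ≠ 0 := (b.isUnit.map Matrix.detMonoidHom).ne_zero
  rw [Matrix.det_of_isUpperTriangular hb] at hd
  exact Finset.prod_ne_zero_iff.1 hd i (Finset.mem_univ i)

theorem oppBorel_apply_self_ne_zero {n : ℕ} {b : GL (Fin n) ℂ} (hb : b ∈ oppBorel n) (i : Fin n) :
    b i i ≠ 0 := by
  have hd : b.val.det ≠ 0 := (b.isUnit.map Matrix.detMonoidHom).ne_zero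
  rw [Matrix.det_of_isLowerTriangular _ hb] at hd
  exact Finset.prod_ne_zero_iff.1 hd i (Finset.mem_univ i)

theorem exists_mem_borel_eq {n : ℕ} {M : Matrix (Fin n) (Fin n) ℂ}
    (h : ∀ i j, j < i → M i j = 0) (hd : ∀ i, M i i ≠ 0) : ∃ b ∈ borel n, b.val = M := by
  have hM : M.BlockTriangular id := fun i j hij => h i j hij
  refine ⟨Matrix.GeneralLinearGroup.mkOfDetNeZero M ?_, hM, rfl⟩
  rw [Matrix.det_of_isUpperTriangular hM]
  exact Finset.prod_ne_zero_iff.2 fun i _ => hd i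

theorem exists_mem_oppBorel_eq {n : ℕ} {M : Matrix (Fin n) (Fin n) ℂ}
    (h : ∀ i j, i < j → M i j = 0) (hd : ∀ i, M i i ≠ 0) : ∃ b ∈ oppBorel n, b.val = M := by
  have hM : M.BlockTriangular OrderDual.toDual :=
    fun i j hij => h i j (OrderDual.toDual_lt_toDual.1 hij)
  refine ⟨Matrix.GeneralLinearGroup.mkOfDetNeZero M ?_, hM, rfl⟩
  rw [Matrix.det_of_isLowerTriangular _ hM]
  exact Finset.prod_ne_zero_iff.2 fun i _ => hd i

/-! ### Removing a direction from a flag -/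

/-- The inverse of `insGL_mem_doubleCosetClosure` for Schubert varieties: deleting the first row and
the column `j` maps `B (ins j w) B` to `B w B`. -/
theorem mem_doubleCosetClosure_borel_of_insGL {n : ℕ} {j : Fin (n + 1)} {w : Equiv.Perm (Fin n)}
    {g : GL (Fin n) ℂ} (hg : insGL j g ∈ doubleCosetClosure (borel (n + 1)) (ins j w)) :
    g ∈ doubleCosetClosure (borel n) w := by
  refine mem_zcl_of_affineMap (incl Fin.succ).transpose (incl j.succAbove) 0 ?_ hg ?_
  · rintro _ ⟨b, hb, b', hb', rfl⟩
    obtain ⟨c, hc, hcb⟩ := exists_mem_borel_eq (M := Matrix.of fun i k : Fin n => b i.succ k.succ)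
      (fun i k hik => (mem_borel b).1 hb _ _ (Fin.succ_lt_succ_iff.2 hik))
      fun i => borel_apply_self_ne_zero hb _
    obtain ⟨c', hc', hcb'⟩ := exists_mem_borel_eq
      (M := Matrix.of fun i k : Fin n => b' (j.succAbove i) (j.succAbove k))
      (fun i k hik => (mem_borel b').1 hb' _ _ (j.strictMono_succAbove hik))
      fun i => borel_apply_self_ne_zero hb' _
    refine ⟨c * permGL w * c', subset_zcl _ ⟨c, hc, c', hc', rfl⟩, ?_⟩
    ext a k
    rw [add_zero, mul_incl_apply, transpose_incl_mul_apply]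
    simp only [Units.val_mul, Matrix.mul_assoc]
    rw [Matrix.mul_apply, Matrix.mul_apply, Fin.sum_univ_succ,
      (mem_borel b).1 hb _ _ (Fin.succ_pos a), zero_mul, zero_add]
    simp only [permGL_mul_apply, ins_symm_succ, hcb, hcb', Matrix.of_apply]
  · ext a k
    rw [add_zero, mul_incl_apply, transpose_incl_mul_apply, insGL_succ_succAbove]

/-- The inverse of `insGL_mem_doubleCosetClosure` for opposite Schubert varieties. The intersection
of a flag with the span of `e_1, …, e_n` is given by the minors of size two of the matrix which
contain the first row and the column `j`; they map `B⁻ (ins j w) B` to `B⁻ w B`. -/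
theorem mem_doubleCosetClosure_oppBorel_of_insGL {n : ℕ} {j : Fin (n + 1)} {w : Equiv.Perm (Fin n)}
    {g : GL (Fin n) ℂ} (hg : insGL j g ∈ doubleCosetClosure (oppBorel (n + 1)) (ins j w)) :
    g ∈ doubleCosetClosure (oppBorel n) w := by
  let φ : Matrix (Fin n) (Fin n) (MvPolynomial (Fin (n + 1) × Fin (n + 1)) ℂ) :=
    Matrix.of fun a c =>
      MvPolynomial.X (a.succ, j.succAbove c) * MvPolynomial.X (0, j) -
        MvPolynomial.X (a.succ, j) * MvPolynomial.X (0, j.succAbove c)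
  have hφ : ∀ (h : GL (Fin (n + 1)) ℂ) (a c : Fin n), φ.map (evalAt h) a c =
      h a.succ (j.succAbove c) * h 0 j - h a.succ j * h 0 (j.succAbove c) := by
    intro h a c
    simp [φ, evalAt]
  refine mem_zcl_of_polynomialMap φ ?_ hg ?_
  · rintro _ ⟨b, hb, b', hb', rfl⟩
    have hb0 := mem_oppBorel b |>.1 hb
    have hb0' := mem_borel b' |>.1 hb'
    obtain ⟨c, hc, hcb⟩ := exists_mem_oppBorel_eq
      (M := Matrix.of fun i k : Fin n => b i.succ k.succ)
      (fun i k hik => hb0 _ _ (Fin.succ_lt_succ_iff.2 hik))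
      fun i => oppBorel_apply_self_ne_zero hb _
    -- In a product `b' j k * b' l j` with `k ≤ l` and `l ≠ j` one of the factors vanishes.
    have hz : ∀ l k : Fin n, k ≤ l → b' (j.succAbove l) j * b' j (j.succAbove k) = 0 := by
      intro l k hkl
      rcases lt_or_ge j (j.succAbove l) with h | h
      · rw [hb0' _ _ h, zero_mul]
      · have h1 : j.succAbove k < j :=
          ((j.strictMono_succAbove.monotone hkl).trans h).lt_of_ne (Fin.succAbove_ne j k)
        rw [hb0' _ _ h1, mul_zero]
    obtain ⟨c', hc', hcb'⟩ := exists_mem_borel_eq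
      (M := Matrix.of fun l k : Fin n => b 0 0 *
        (b' (j.succAbove l) (j.succAbove k) * b' j j - b' (j.succAbove l) j * b' j (j.succAbove k)))
      (fun l k hlk => by
        rw [Matrix.of_apply, hz l k hlk.le, hb0' _ _ (j.strictMono_succAbove hlk)]
        ring)
      (fun l => by
        rw [Matrix.of_apply, hz l l le_rfl, sub_zero]
        exact mul_ne_zero (oppBorel_apply_self_ne_zero hb _)
          (mul_ne_zero (borel_apply_self_ne_zero hb' _) (borel_apply_self_ne_zero hb' _)))
    refine ⟨c * permGL w * c', subset_zcl _ ⟨c, hc, c', hc', rfl⟩, ?_⟩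
    have h0 : ∀ x, (b * permGL (ins j w) * b') 0 x = b 0 0 * b' j x := by
      intro x
      rw [mul_assoc, Units.val_mul, Matrix.mul_apply, Fin.sum_univ_succ, Finset.sum_eq_zero,
        add_zero, Units.val_mul, permGL_mul_apply, ins_symm_zero]
      intro d _
      rw [hb0 _ _ (Fin.succ_pos d), zero_mul]
    have h1 : ∀ a x, (b * permGL (ins j w) * b') (Fin.succ a) x =
        b a.succ 0 * b' j x + ∑ d, b a.succ d.succ * b' (j.succAbove (w.symm d)) x := by
      intro a x
      rw [mul_assoc, Units.val_mul, Matrix.mul_apply, Fin.sum_univ_succ, Units.val_mul]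
      simp only [permGL_mul_apply, ins_symm_zero, ins_symm_succ]
    ext a k
    rw [hφ, h0, h0, h1, h1, mul_assoc, Units.val_mul, Matrix.mul_apply, Units.val_mul]
    simp only [permGL_mul_apply, hcb, hcb', Matrix.of_apply]
    have : ∀ s β γ X Y e : ℂ, (s * β + X) * (e * γ) - (s * γ + Y) * (e * β) =
        X * (e * γ) - Y * (e * β) := fun _ _ _ _ _ _ => by ring
    rw [this, Finset.sum_mul, Finset.sum_mul, ← Finset.sum_sub_distrib]
    refine Finset.sum_congr rfl fun d _ => ?_
    ring
  · ext a k
    rw [hφ, insGL_succ_succAbove, insGL_self, insGL_self, if_pos rfl, if_neg (Fin.succ_ne_zero a)]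
    ring

/-! ### Incidence conditions on Richardson varieties -/

theorem inv_apply_eq_zero_iff {n : ℕ} (h : GL (Fin n) ℂ) (i k : Fin n) :
    h⁻¹ i k = 0 ↔ polyEval h ((Matrix.mvPolynomialX (Fin n) (Fin n) ℂ).adjugate i k) = 0 := by
  have h1 : polyEval h ((Matrix.mvPolynomialX (Fin n) (Fin n) ℂ).adjugate i k) =
      h.val.adjugate i k := by
    have := RingHom.map_adjugate (evalAt h) (Matrix.mvPolynomialX (Fin n) (Fin n) ℂ)
    rw [RingHom.mapMatrix_apply, RingHom.mapMatrix_apply, mvPolynomialX_map_evalAt] at this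
    rw [← this, Matrix.map_apply, polyEval_eq]
  have hd : IsUnit h.val.det := h.isUnit.map Matrix.detMonoidHom
  rw [h1, Matrix.coe_units_inv, Matrix.inv_def, Matrix.smul_apply, smul_eq_mul,
    mul_eq_zero_iff_left]
  rw [Ring.inverse_eq_inv']
  exact inv_ne_zero hd.ne_zero

/-- On the Schubert variety of `v` with `v j = 0`, the `(j + 1)`-dimensional space of the flag
contains `e_0`. -/
theorem inv_apply_zero_of_mem {n : ℕ} {v : Equiv.Perm (Fin (n + 1))} {j k : Fin (n + 1)}
    (hv : v j = 0) (hjk : j < k) {h : GL (Fin (n + 1)) ℂ}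
    (hh : h ∈ doubleCosetClosure (borel (n + 1)) v) : h⁻¹ k 0 = 0 := by
  rw [inv_apply_eq_zero_iff]
  refine hh _ ?_
  rintro _ ⟨b, hb, b', hb', rfl⟩
  rw [← inv_apply_eq_zero_iff, mul_inv_rev, mul_inv_rev, ← mul_assoc, Units.val_mul,
    Matrix.mul_apply, Fin.sum_univ_succ, Finset.sum_eq_zero, add_zero, ← permGL_inv,
    Units.val_mul, coe_permGL, mul_incl_apply]
  · have : v⁻¹ 0 = j := by rw [← hv]; simp
    rw [this, (mem_borel _).1 (inv_mem hb') _ _ hjk, zero_mul]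
  · intro d _
    rw [(mem_borel _).1 (inv_mem hb) _ _ (Fin.succ_pos d), mul_zero]

/-- On the opposite Schubert variety of `u` with `u j = 0`, the `j`-dimensional space of the flag
is contained in the span of `e_1, …, e_n`. -/
theorem apply_zero_of_mem {n : ℕ} {u : Equiv.Perm (Fin (n + 1))} {j k : Fin (n + 1)}
    (hu : u j = 0) (hkj : k < j) {h : GL (Fin (n + 1)) ℂ}
    (hh : h ∈ doubleCosetClosure (oppBorel (n + 1)) u) : h 0 k = 0 := by
  have hX : ∀ h : GL (Fin (n + 1)) ℂ, polyEval h (MvPolynomial.X (0, k)) = h 0 k := fun h => by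
    simp [polyEval]
  rw [← hX]
  refine hh _ ?_
  rintro _ ⟨b, hb, b', hb', rfl⟩
  rw [hX, mul_assoc, Units.val_mul, Matrix.mul_apply, Fin.sum_univ_succ, Finset.sum_eq_zero,
    add_zero, Units.val_mul, permGL_mul_apply, ← hu, Equiv.symm_apply_apply,
    (mem_borel b').1 hb' _ _ hkj, mul_zero]
  intro d _
  rw [(mem_oppBorel b).1 hb _ _ (Fin.succ_pos d), zero_mul]

theorem exists_kap_above_eq {n : ℕ} {j : Fin (n + 1)} {X : GL (Fin (n + 1)) ℂ}
    (h1 : ∀ c, X j (j.succAbove c) = 0) (h2 : ∀ c, X (j.succAbove c) j = 0) (h3 : X j j = 1) :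
    ∃ g, X = kap (above j) g := by
  let g : GL (Fin n) ℂ :=
    { val := Matrix.of fun a c => X (j.succAbove a) (j.succAbove c)
      inv := Matrix.of fun a c => X⁻¹ (j.succAbove a) (j.succAbove c)
      val_inv := by
        ext a c
        have h : (X * X⁻¹) (j.succAbove a) (j.succAbove c) = (1 : Matrix _ _ ℂ) a c := by
          simp [Matrix.one_apply]
        rw [Units.val_mul, Matrix.mul_apply, Fin.sum_univ_succAbove _ j, h2, zero_mul,
          zero_add] at h
        rw [← h, Matrix.mul_apply]
        rfl
      inv_val := by
        ext a c
        have h : (X⁻¹ * X) (j.succAbove a) (j.succAbove c) = (1 : Matrix _ _ ℂ) a c := by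
          simp [Matrix.one_apply]
        rw [Units.val_mul, Matrix.mul_apply, Fin.sum_univ_succAbove _ j, h1, mul_zero,
          zero_add] at h
        rw [← h, Matrix.mul_apply]
        rfl }
  refine ⟨g, ?_⟩
  ext i k
  rcases Fin.eq_self_or_eq_succAbove j i with rfl | ⟨a, rfl⟩
  · rw [kap_apply_left _ _ (Fin.succAbove_ne i)]
    rcases Fin.eq_self_or_eq_succAbove i k with rfl | ⟨c, rfl⟩
    · rw [h3, if_pos rfl]
    · rw [h1, if_neg (Fin.ne_succAbove i c)]
  · rcases Fin.eq_self_or_eq_succAbove j k with rfl | ⟨c, rfl⟩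
    · rw [kap_apply_right _ _ (Fin.succAbove_ne k), h2, if_neg (Fin.succAbove_ne k a)]
    · exact (kap_apply_apply (above j) g a c).symm

/-- A flag whose `j`-dimensional space is contained in the span of `e_1, …, e_n`, and whose
`(j + 1)`-dimensional space contains `e_0`, is obtained by inserting `e_0` into a smaller flag. -/
theorem exists_mul_eq_insGL {n : ℕ} {j : Fin (n + 1)} {h : GL (Fin (n + 1)) ℂ}
    (h1 : ∀ k, j < k → h⁻¹ k 0 = 0) (h2 : ∀ k, k < j → h 0 k = 0) :
    ∃ b ∈ borel (n + 1), ∃ g, h * b = insGL j g := by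
  have hh : ∀ i, ∑ l, h i l * h⁻¹ l 0 = if i = 0 then 1 else 0 := by
    intro i
    rw [← Matrix.mul_apply, ← Units.val_mul, mul_inv_cancel, Units.val_one, Matrix.one_apply]
  have hj : h 0 j * h⁻¹ j 0 = 1 := by
    have := hh 0
    rw [if_pos rfl, Finset.sum_eq_single j] at this
    · exact this
    · intro l _ hl
      rcases lt_or_gt_of_ne hl with h' | h'
      · rw [h2 l h', zero_mul]
      · rw [h1 l h', mul_zero]
    · simp
  -- The column `j` of `h * b` is `e_0`, which then clears the first row of the other columns.
  obtain ⟨b, hb, hbM⟩ := exists_mem_borel_eq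
    (M := Matrix.of fun l k => if k = j then h⁻¹ l 0 else
      (if l = k then 1 else 0) - h 0 k * h⁻¹ l 0)
    (fun l k hkl => by
      rw [Matrix.of_apply]
      split_ifs with hk hlk
      · exact h1 l (hk ▸ hkl)
      · exact absurd hlk hkl.ne'
      · rcases lt_or_gt_of_ne hk with h' | h'
        · rw [h2 k h', zero_mul, sub_zero]
        · rw [h1 l (h'.trans hkl), mul_zero, sub_zero])
    (fun l => by
      rw [Matrix.of_apply, if_pos rfl]
      split_ifs with hl
      · rw [hl]
        exact right_ne_zero_of_mul_eq_one hj
      · rcases lt_or_gt_of_ne hl with h' | h'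
        · rw [h2 l h', zero_mul, sub_zero]
          exact one_ne_zero
        · rw [h1 l h', mul_zero, sub_zero]
          exact one_ne_zero)
  have hcol : ∀ i, (h * b) i j = if i = 0 then 1 else 0 := by
    intro i
    rw [Units.val_mul, Matrix.mul_apply, ← hh i, hbM]
    simp only [Matrix.of_apply, if_pos]
  have hrow : ∀ c, (h * b) 0 (j.succAbove c) = 0 := by
    intro c
    rw [Units.val_mul, Matrix.mul_apply, hbM]
    simp only [Matrix.of_apply, if_neg (Fin.succAbove_ne j c), mul_sub, Finset.sum_sub_distrib,
      mul_ite, mul_one, mul_zero, Finset.sum_ite_eq', Finset.mem_univ, if_true]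
    have : ∀ x, h 0 x * (h 0 (j.succAbove c) * h⁻¹ x 0) =
        h 0 (j.succAbove c) * (h 0 x * h⁻¹ x 0) := fun x => by ring
    simp only [this, ← Finset.mul_sum, hh, if_true, mul_one, sub_self]
  have hX : ∀ i k, ((permGL (ins j 1))⁻¹ * (h * b)) i k = (h * b) (ins j 1 i) k := by
    intro i k
    rw [← permGL_inv, Units.val_mul, permGL_mul_apply]
    rfl
  obtain ⟨g, hg⟩ := exists_kap_above_eq (j := j) (X := (permGL (ins j 1))⁻¹ * (h * b))
    (fun c => by rw [hX, ins_self, hrow])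
    (fun c => by rw [hX, hcol, ins_succAbove, if_neg (Fin.succ_ne_zero _)])
    (by rw [hX, hcol, ins_self, if_pos rfl])
  exact ⟨b, hb, g, by rw [insGL, ← hg, mul_inv_cancel_left]⟩

/-! ### The recursion for Richardson varieties -/

theorem kap_succEmb_mem_borel {n : ℕ} (b : GL (Fin n) ℂ) (hb : b ∈ borel n) :
    kap (Fin.succEmb n) b ∈ borel (n + 1) :=
  kap_mem_borel fun i k h => (mem_borel b).1 hb i k (Fin.succ_lt_succ_iff.1 h)

theorem kap_succEmb_mem_oppBorel {n : ℕ} (b : GL (Fin n) ℂ) (hb : b ∈ oppBorel n) :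
    kap (Fin.succEmb n) b ∈ oppBorel (n + 1) :=
  kap_mem_oppBorel fun i k h => (mem_oppBorel b).1 hb i k (Fin.succ_lt_succ_iff.1 h)

/-- If the value `0` has the same position `j` in both permutations, the Richardson variety consists
of the flags of a smaller Richardson variety with `e_0` inserted. -/
theorem mem_ins_ins_iff {n : ℕ} {u v : Equiv.Perm (Fin n)} {j : Fin (n + 1)}
    {g : GL (Fin (n + 1)) ℂ} :
    (g ∈ doubleCosetClosure (borel (n + 1)) (ins j v) ∧
      g ∈ doubleCosetClosure (oppBorel (n + 1)) (ins j u)) ↔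
    ∃ g', (g' ∈ doubleCosetClosure (borel n) v ∧ g' ∈ doubleCosetClosure (oppBorel n) u) ∧
      ∃ b ∈ borel (n + 1), g = insGL j g' * b := by
  constructor
  · rintro ⟨hv, hu⟩
    obtain ⟨b, hb, g', hg'⟩ := exists_mul_eq_insGL
      (fun k hk => inv_apply_zero_of_mem (ins_self j v) hk hv)
      (fun k hk => apply_zero_of_mem (ins_self j u) hk hu)
    refine ⟨g', ⟨mem_doubleCosetClosure_borel_of_insGL (j := j) ?_,
      mem_doubleCosetClosure_oppBorel_of_insGL (j := j) ?_⟩, b⁻¹, inv_mem hb, ?_⟩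
    · rw [← hg']
      exact mul_borel_mem_doubleCosetClosure hb hv
    · rw [← hg']
      exact mul_borel_mem_doubleCosetClosure hb hu
    · rw [← hg', mul_inv_cancel_right]
  · rintro ⟨g', ⟨hv, hu⟩, b, hb, rfl⟩
    exact ⟨mul_borel_mem_doubleCosetClosure hb
        (insGL_mem_doubleCosetClosure kap_succEmb_mem_borel j hv),
      mul_borel_mem_doubleCosetClosure hb
        (insGL_mem_doubleCosetClosure kap_succEmb_mem_oppBorel j hu)⟩

theorem mul_parab_mem_borel_ins_succ {n : ℕ} {w : Equiv.Perm (Fin n)} {j : Fin n}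
    {g p : GL (Fin (n + 1)) ℂ} (hg : g ∈ doubleCosetClosure (borel (n + 1)) (ins j.succ w))
    (hp : p ∈ parab j) : g * p ∈ doubleCosetClosure (borel (n + 1)) (ins j.succ w) := by
  refine mul_parab_mem_doubleCosetClosure (fun A hA => kap_mem_borel fun a c hac => ?_) hg hp
  fin_cases a <;> fin_cases c <;> simp [ins_self] at hac
  exact hA

theorem mul_parab_mem_oppBorel_ins_castSucc {n : ℕ} {w : Equiv.Perm (Fin n)} {j : Fin n}
    {g p : GL (Fin (n + 1)) ℂ} (hg : g ∈ doubleCosetClosure (oppBorel (n + 1)) (ins j.castSucc w))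
    (hp : p ∈ parab j) : g * p ∈ doubleCosetClosure (oppBorel (n + 1)) (ins j.castSucc w) := by
  refine mul_parab_mem_doubleCosetClosure (fun A hA => kap_mem_oppBorel fun a c hac => ?_) hg hp
  fin_cases a <;> fin_cases c <;> simp [ins_self] at hac
  exact hA

theorem val_succAbove {n : ℕ} (i : Fin (n + 1)) (a : Fin n) :
    (i.succAbove a).val = if a.val < i.val then a.val else a.val + 1 := by
  rw [Fin.succAbove, apply_ite Fin.val]
  rfl

theorem swap_succAbove_succ {n : ℕ} (j a : Fin n) :
    Equiv.swap j.castSucc j.succ (j.succ.succAbove a) = j.castSucc.succAbove a := by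
  rw [Equiv.swap_apply_def]
  simp only [Fin.ext_iff, apply_ite Fin.val, val_succAbove, Fin.val_succ, Fin.val_castSucc]
  split_ifs <;> omega

/-- Exchanging the columns `j` and `j + 1` moves the inserted column by one position. -/
theorem insGL_castSucc_mul_swap {n : ℕ} (j : Fin n) (g : GL (Fin n) ℂ) :
    insGL j.castSucc g * permGL (Equiv.swap j.castSucc j.succ) = insGL j.succ g := by
  have h1 : (above j.succ).trans (Equiv.swap j.castSucc j.succ).toEmbedding =
      above j.castSucc := by
    ext a
    exact congrArg Fin.val (swap_succAbove_succ j a)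
  have h2 : ins j.castSucc 1 * Equiv.swap j.castSucc j.succ = ins j.succ 1 := by
    ext1 k
    rw [Equiv.Perm.mul_apply]
    rcases Fin.eq_self_or_eq_succAbove j.succ k with rfl | ⟨a, rfl⟩
    · rw [Equiv.swap_apply_right, ins_self, ins_self]
    · rw [swap_succAbove_succ, ins_succAbove, ins_succAbove]
  rw [insGL, insGL, mul_assoc, ← h1, ← permGL_mul_kap, ← mul_assoc, ← permGL_mul, h2]

theorem swap_mem_parab {n : ℕ} (j : Fin n) :
    permGL (Equiv.swap j.castSucc j.succ) ∈ parab j := by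
  rw [mem_parab]
  intro k l hlk hne
  rw [permGL_apply, if_neg]
  rintro rfl
  by_cases h1 : l = j.castSucc
  · subst h1
    exact hne ⟨Equiv.swap_apply_left _ _, rfl⟩
  by_cases h2 : l = j.succ
  · subst h2
    rw [Equiv.swap_apply_right] at hlk
    simp [Fin.lt_def] at hlk
  · rw [Equiv.swap_apply_of_ne_of_ne h1 h2] at hlk
    exact lt_irrefl _ hlk

/-- If `e_0` only lies in the `(j + 2)`-dimensional space of the flag, the `(j + 1)`-dimensional
space can be replaced by the sum of `e_0` and the `j`-dimensional space. -/
theorem exists_parab_mul_eq_insGL {n : ℕ} {j : Fin n} {h : GL (Fin (n + 1)) ℂ}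
    (h1 : ∀ k, j.succ < k → h⁻¹ k 0 = 0) (h2 : ∀ k, k < j.castSucc → h 0 k = 0) :
    ∃ p ∈ parab j, ∃ g, h * p = insGL j.castSucc g := by
  have hh : ∑ c, h 0 (pair j c) * h⁻¹ (pair j c) 0 = 1 := by
    have : (h * h⁻¹) 0 0 = 1 := by simp
    rw [← this, Units.val_mul, Matrix.mul_apply]
    refine Fintype.sum_of_injective (pair j) (pair j).injective _ _ (fun i hi => ?_) fun _ => rfl
    have hi0 : i.val ≠ j.val := fun h => hi ⟨0, Fin.ext h.symm⟩
    have hi1 : i.val ≠ j.val + 1 := fun h => hi ⟨1, Fin.ext h.symm⟩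
    rcases lt_or_gt_of_ne hi0 with h' | h'
    · rw [h2 i h', zero_mul]
    · rw [h1 i, mul_zero]
      rw [Fin.lt_def, Fin.val_succ]
      omega
  rw [Fin.sum_univ_two, pair_zero, pair_one] at hh
  -- The first column of this matrix moves `e_0` into the span of the columns up to `j`.
  let A : GL (Fin 2) ℂ := Matrix.GeneralLinearGroup.mkOfDetNeZero
    !![h⁻¹ j.castSucc 0, -h 0 j.succ; h⁻¹ j.succ 0, h 0 j.castSucc] (by
      rw [Matrix.det_fin_two_of]
      have : h⁻¹ j.castSucc 0 * h 0 j.castSucc - -h 0 j.succ * h⁻¹ j.succ 0 = 1 := by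
        rw [← hh]
        ring
      rw [this]
      exact one_ne_zero)
  have hA : ∀ c, h⁻¹ (pair j c) 0 = A c 0 := by
    intro c
    fin_cases c <;> rfl
  obtain ⟨b, hb, g, hg⟩ := exists_mul_eq_insGL (j := j.castSucc) (h := h * kap (pair j) A)
    (fun k hk => by
      rw [mul_inv_rev, ← map_inv, Units.val_mul]
      by_cases hk1 : k = j.succ
      · subst hk1
        refine (kap_mul_apply (pair j) A⁻¹ h⁻¹.val 1 0).trans ?_
        simp only [hA]
        rw [← Matrix.mul_apply, ← Units.val_mul, inv_mul_cancel]
        rfl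
      · have hk' : k.val ≠ j.val + 1 := fun h => hk1 (Fin.ext h)
        rw [Fin.lt_def, Fin.val_castSucc] at hk
        rw [kap_mul_apply_of_forall_ne, h1 k]
        · rw [Fin.lt_def, Fin.val_succ]
          omega
        · intro a
          fin_cases a <;> simp [Fin.ext_iff] <;> omega)
    (fun k hk => by
      rw [Units.val_mul, mul_kap_apply_of_forall_ne, h2 k hk]
      rw [Fin.lt_def, Fin.val_castSucc] at hk
      intro a
      fin_cases a <;> simp [Fin.ext_iff] <;> omega)
  exact ⟨kap (pair j) A * b, mul_mem (kap_pair_mem_parab j A) (borel_le_parab j hb), g,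
    by rw [← mul_assoc, hg]⟩

/-- If the value `0` has adjacent positions in the two permutations, the Richardson variety is a
bundle of projective lines over a smaller one: the `(j + 1)`-dimensional space is arbitrary. -/
theorem mem_ins_succ_ins_castSucc_iff {n : ℕ} {u v : Equiv.Perm (Fin n)} {j : Fin n}
    {g : GL (Fin (n + 1)) ℂ} :
    (g ∈ doubleCosetClosure (borel (n + 1)) (ins j.succ v) ∧
      g ∈ doubleCosetClosure (oppBorel (n + 1)) (ins j.castSucc u)) ↔
    ∃ g', (g' ∈ doubleCosetClosure (borel n) v ∧ g' ∈ doubleCosetClosure (oppBorel n) u) ∧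
      ∃ p ∈ parab j, g = insGL j.castSucc g' * p := by
  constructor
  · rintro ⟨hv, hu⟩
    obtain ⟨p, hp, g', hg'⟩ := exists_parab_mul_eq_insGL
      (fun k hk => inv_apply_zero_of_mem (ins_self j.succ v) hk hv)
      (fun k hk => apply_zero_of_mem (ins_self j.castSucc u) hk hu)
    refine ⟨g', ⟨mem_doubleCosetClosure_borel_of_insGL (j := j.succ) ?_,
      mem_doubleCosetClosure_oppBorel_of_insGL (j := j.castSucc) ?_⟩, p⁻¹, inv_mem hp, ?_⟩
    -- Only the closure of `B v B` needs `e_0` in the column `j + 1`; it is stable under the exchange.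
    · rw [← insGL_castSucc_mul_swap, ← hg', mul_assoc]
      exact mul_parab_mem_borel_ins_succ hv (mul_mem hp (swap_mem_parab j))
    · rw [← hg']
      exact mul_parab_mem_oppBorel_ins_castSucc hu hp
    · rw [← hg', mul_inv_cancel_right]
  · rintro ⟨g', ⟨hv, hu⟩, p, hp, rfl⟩
    refine ⟨?_, mul_parab_mem_oppBorel_ins_castSucc
      (insGL_mem_doubleCosetClosure kap_succEmb_mem_oppBorel _ hu) hp⟩
    have h := mul_parab_mem_borel_ins_succ
      (insGL_mem_doubleCosetClosure kap_succEmb_mem_borel j.succ hv)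
      (mul_mem (inv_mem (swap_mem_parab j)) hp)
    rwa [← insGL_castSucc_mul_swap, mul_assoc, mul_inv_cancel_left] at h

/-! ### The translated Richardson varieties -/

/-- The preimage in `GL_n` of the translate `u(Ω)⁻¹ X(Ω)`. -/
def RTSeq.translate {n : ℕ} (Ω : RTSeq n) : Set (GL (Fin n) ℂ) :=
  {g | FlagVar.mk (permGL Ω.u * g) ∈ Ω.X}

theorem RTSeq.mem_translate {n : ℕ} {Ω : RTSeq n} {g : GL (Fin n) ℂ} :
    g ∈ Ω.translate ↔ permGL Ω.u * g ∈ doubleCosetClosure (borel n) Ω.v ∧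
      permGL Ω.u * g ∈ doubleCosetClosure (oppBorel n) Ω.u :=
  mk_mem_richardson_iff

theorem permGL_ins_mul_eq_iff {n : ℕ} {j : Fin (n + 1)} {w : Equiv.Perm (Fin n)}
    {g q : GL (Fin (n + 1)) ℂ} {s : GL (Fin n) ℂ} :
    permGL (ins j w) * g = insGL j (permGL w * s) * q ↔ g = kap (above j) s * q := by
  rw [insGL_mul, insGL_permGL, mul_assoc, mul_right_inj]

theorem RTSeq.translate_r {n : ℕ} (Ω : RTSeq n) (j : Fin (n + 1)) :
    (Ω.r j).translate = extend j (borel (n + 1)) Ω.translate := by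
  ext g
  rw [RTSeq.mem_translate]
  refine mem_ins_ins_iff.trans ?_
  constructor
  · rintro ⟨g', hg', b, hb, h⟩
    obtain ⟨s, rfl⟩ : ∃ s, g' = permGL Ω.u * s := ⟨(permGL Ω.u)⁻¹ * g', by simp⟩
    exact ⟨s, RTSeq.mem_translate.2 hg', b, hb, permGL_ins_mul_eq_iff.1 h⟩
  · rintro ⟨s, hs, b, hb, h⟩
    exact ⟨permGL Ω.u * s, RTSeq.mem_translate.1 hs, b, hb, permGL_ins_mul_eq_iff.2 h⟩

theorem RTSeq.translate_t {n : ℕ} (Ω : RTSeq n) (j : Fin n) :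
    (Ω.t j).translate = extend j.castSucc (parab j) Ω.translate := by
  ext g
  rw [RTSeq.mem_translate]
  refine mem_ins_succ_ins_castSucc_iff.trans ?_
  constructor
  · rintro ⟨g', hg', p, hp, h⟩
    obtain ⟨s, rfl⟩ : ∃ s, g' = permGL Ω.u * s := ⟨(permGL Ω.u)⁻¹ * g', by simp⟩
    exact ⟨s, RTSeq.mem_translate.2 hg', p, hp, permGL_ins_mul_eq_iff.1 h⟩
  · rintro ⟨s, hs, p, hp, h⟩
    exact ⟨permGL Ω.u * s, RTSeq.mem_translate.1 hs, p, hp, permGL_ins_mul_eq_iff.2 h⟩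

/-! ### Left translations are isomorphisms of varieties -/

theorem exists_polyEval_mul_left {n : ℕ} (a : GL (Fin n) ℂ) (p : MvPolynomial (Fin n × Fin n) ℂ) :
    ∃ q, ∀ g, polyEval g q = polyEval (a * g) p := by
  let φ : Matrix (Fin n) (Fin n) (MvPolynomial (Fin n × Fin n) ℂ) :=
    (a.val.map MvPolynomial.C : Matrix (Fin n) (Fin n) (MvPolynomial (Fin n × Fin n) ℂ)) *
      Matrix.mvPolynomialX (Fin n) (Fin n) ℂ
  refine ⟨_, fun g => polyEval_bind₁ (φ := φ) ?_ p⟩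
  rw [Matrix.map_mul, map_C_evalAt, mvPolynomialX_map_evalAt, Units.val_mul]

theorem isOpen_preimage_smul {n : ℕ} (a : GL (Fin n) ℂ) {U : Set (FlagVar n)} (hU : IsOpen U) :
    IsOpen ((fun x => a • x) ⁻¹' U) := by
  rw [FlagVar.isOpen_iff] at hU ⊢
  intro g hg
  obtain ⟨p, hp, hpU⟩ := hU (a * g) hg
  obtain ⟨q, hq⟩ := exists_polyEval_mul_left a p
  exact ⟨q, by rwa [hq], fun h hh => hpU (a * h) (by rwa [← hq])⟩

theorem continuous_smul_flagVar {n : ℕ} (a : GL (Fin n) ℂ) :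
    Continuous fun x : FlagVar n => a • x :=
  ⟨fun _ hU => isOpen_preimage_smul a hU⟩

theorem RegularOnFlag.comp_smul {n : ℕ} (a : GL (Fin n) ℂ) {U : Set (FlagVar n)}
    {f : FlagVar n → ℂ} (hf : RegularOnFlag U f) :
    RegularOnFlag ((fun x => a • x) ⁻¹' U) fun x => f (a • x) := by
  intro g hg
  obtain ⟨p, q, hq, hpq⟩ := hf (a * g) hg
  obtain ⟨p', hp'⟩ := exists_polyEval_mul_left a p
  obtain ⟨q', hq'⟩ := exists_polyEval_mul_left a q
  refine ⟨p', q', by rwa [hq'], fun h hh hqh => ?_⟩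
  rw [hp', hq']
  exact hpq (a * h) hh (by rwa [← hq'])

theorem RegularOnSub.comp_smul {n : ℕ} (a : GL (Fin n) ℂ) {Z Z' : Set (FlagVar n)} (φ : Z → Z')
    (hφ : ∀ x, (φ x : FlagVar n) = a • (x : FlagVar n)) {V : Set Z'} {f : Z' → ℂ}
    (hf : RegularOnSub V f) : RegularOnSub (φ ⁻¹' V) (f ∘ φ) := by
  intro z hz
  obtain ⟨U, hU, hzU, F, hF, hfF⟩ := hf (φ z) hz
  rw [hφ] at hzU
  refine ⟨_, isOpen_preimage_smul a hU, hzU, _, hF.comp_smul a, fun y hy hyU => ?_⟩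
  rw [Function.comp_apply, hfF (φ y) hy (by rw [hφ]; exact hyU), hφ]

theorem isVarietyIso_of_smul {n : ℕ} (a : GL (Fin n) ℂ) {Z Z' : Set (FlagVar n)} (e : Z ≃ Z')
    (he : ∀ x, (e x : FlagVar n) = a • (x : FlagVar n)) : IsVarietyIso e := by
  have he' : ∀ y, (e.symm y : FlagVar n) = a⁻¹ • (y : FlagVar n) := fun y => by
    rw [eq_inv_smul_iff, ← he, Equiv.apply_symm_apply]
  refine ⟨continuous_induced_rng.2 ?_, continuous_induced_rng.2 ?_, fun V f _ => ⟨fun h =>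
    h.comp_smul a e he, fun h => ?_⟩⟩
  · have : Subtype.val ∘ e = (fun x : FlagVar n => a • x) ∘ Subtype.val := funext he
    rw [this]
    exact (continuous_smul_flagVar a).comp continuous_subtype_val
  · have : Subtype.val ∘ e.symm = (fun x : FlagVar n => a⁻¹ • x) ∘ Subtype.val := funext he'
    rw [this]
    exact (continuous_smul_flagVar a⁻¹).comp continuous_subtype_val
  · have := h.comp_smul a⁻¹ e.symm he'
    rwa [← Set.preimage_comp, Function.comp_assoc, Equiv.self_comp_symm, Set.preimage_id,
      Function.comp_id] at this

theorem RTSeq.isClosed_smul_X {n : ℕ} (Ω : RTSeq n) (a : GL (Fin n) ℂ) :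
    IsClosed (a • Ω.X) := by
  have hX : IsClosed Ω.X := isClosed_closure.inter isClosed_closure
  rw [← Set.preimage_smul_inv]
  exact hX.preimage (continuous_smul_flagVar a⁻¹)

theorem RTSeq.smul_X_eq_of_translate_eq {n : ℕ} {Ω Ω' : RTSeq n}
    (h : Ω.translate = Ω'.translate) : (permGL Ω.u)⁻¹ • Ω.X = (permGL Ω'.u)⁻¹ • Ω'.X := by
  ext x
  obtain ⟨g, rfl⟩ := FlagVar.mk_surjective x
  rw [Set.mem_inv_smul_set_iff, Set.mem_inv_smul_set_iff]
  exact Set.ext_iff.1 h g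

theorem RTSeq.exists_isVarietyIso {n : ℕ} (Ω : RTSeq n) (a : GL (Fin n) ℂ) {Y : Set (FlagVar n)}
    (hY : Y = a • Ω.X) : ∃ e : Ω.X ≃ Y, IsVarietyIso e ∧
      ∀ x : Ω.X, (e x : FlagVar n) = a • (x : FlagVar n) := by
  subst hY
  let e : Ω.X ≃ (a • Ω.X : Set (FlagVar n)) :=
    (MulAction.toPerm a).subtypeEquiv fun x => (Set.smul_mem_smul_set_iff).symm
  exact ⟨e, isVarietyIso_of_smul a e fun _ => rfl, fun _ => rfl⟩

/-! ### Removing leaves and cherries from trees -/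

namespace LTree

theorem subst_leaf (T : LTree) : T.subst leaf = T := by
  induction T with
  | leaf k => rfl
  | node l r hl hr => rw [subst, hl, hr]

theorem subst_subst (f g : ℕ → LTree) (T : LTree) :
    (T.subst f).subst g = T.subst fun k => (f k).subst g := by
  induction T with
  | leaf k => rfl
  | node l r hl hr => simp only [subst, hl, hr]

theorem subst_congr {f g : ℕ → LTree} {T : LTree} (h : ∀ k ∈ T.leaves, f k = g k) :
    T.subst f = T.subst g := by
  induction T with
  | leaf k => exact h k (by simp [leaves])
  | node l r hl hr =>
    simp only [leaves, List.mem_append] at h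
    rw [subst, subst, hl fun k hk => h k (Or.inl hk), hr fun k hk => h k (Or.inr hk)]

theorem exists_mem_leaves (T : LTree) : ∃ k, k ∈ T.leaves := by
  induction T with
  | leaf k => exact ⟨k, by simp [leaves]⟩
  | node l r hl _ =>
    obtain ⟨k, hk⟩ := hl
    exact ⟨k, by simp [leaves, hk]⟩

/-- Renumber the leaves after the removal of the trivial tree `i`. -/
def unshift (i : ℕ) : LTree → LTree := subst fun k => leaf (if k < i then k else k - 1)

theorem unshift_shift (i : ℕ) (T : LTree) : (T.shift i).unshift i = T := by
  rw [unshift, shift, subst_subst]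
  conv_rhs => rw [← subst_leaf T]
  refine subst_congr fun k _ => ?_
  split_ifs with h
  · simp [subst, h]
  · have : ¬ k + 1 < i := by omega
    simp [subst, this]

theorem shift_unshift {i : ℕ} {T : LTree} (h : i ∉ T.leaves) : (T.unshift i).shift i = T := by
  rw [unshift, shift, subst_subst]
  conv_rhs => rw [← subst_leaf T]
  refine subst_congr fun k hk => ?_
  have hki : k ≠ i := fun e => h (e ▸ hk)
  simp only [subst]
  split_ifs <;> first | rfl | omega | (congr 1; omega)

theorem shift_injective (i : ℕ) : Function.Injective (shift i) :=
  Function.LeftInverse.injective (unshift_shift i)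

theorem eq_of_shift_eq_leaf {i k : ℕ} {T : LTree} (h : T.shift i = leaf k) :
    T = leaf (if k < i then k else k - 1) := by
  rw [← unshift_shift i T, h]
  rfl

open Classical in
/-- Replace the cherry with leaves `i` and `i + 1` by the leaf `i`, and renumber the leaves. -/
noncomputable def unsplit (i : ℕ) : LTree → LTree
  | leaf k => leaf (if k ≤ i then k else k - 1)
  | node l r => if l = leaf i ∧ r = leaf (i + 1) then leaf i else node (l.unsplit i) (r.unsplit i)

theorem split_node (i : ℕ) (l r : LTree) : (node l r).split i = node (l.split i) (r.split i) := rfl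

theorem split_leaf_of_lt {i k : ℕ} (h : k < i) : (leaf k).split i = leaf k := by
  simp [split, subst, h]

theorem split_leaf_self (i : ℕ) : (leaf i).split i = node (leaf i) (leaf (i + 1)) := by
  simp [split, subst]

theorem split_leaf_of_gt {i k : ℕ} (h : i < k) : (leaf k).split i = leaf (k + 1) := by
  simp [split, subst, h.not_gt, h.ne']

theorem shift_leaf_of_lt {i k : ℕ} (h : k < i) : (leaf k).shift i = leaf k := by
  simp [shift, subst, h]

theorem shift_leaf_of_le {i k : ℕ} (h : i ≤ k) : (leaf k).shift i = leaf (k + 1) := by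
  simp [shift, subst, h.not_gt]

theorem split_ne_leaf (i : ℕ) (T : LTree) : T.split i ≠ leaf i ∧ T.split i ≠ leaf (i + 1) := by
  cases T with
  | leaf k =>
    rcases lt_trichotomy k i with h | rfl | h
    · rw [split_leaf_of_lt h]
      simp only [ne_eq, leaf.injEq]
      omega
    · rw [split_leaf_self]
      simp
    · rw [split_leaf_of_gt h]
      simp only [ne_eq, leaf.injEq]
      omega
  | node l r => simp [split_node]

theorem unsplit_split (i : ℕ) (T : LTree) : (T.split i).unsplit i = T := by
  induction T with
  | leaf k =>
    rcases lt_trichotomy k i with h | rfl | h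
    · simp [split_leaf_of_lt h, unsplit, h.le]
    · simp [split_leaf_self, unsplit]
    · have : ¬ k + 1 ≤ i := by omega
      simp [split_leaf_of_gt h, unsplit, this]
  | node l r hl hr =>
    rw [split_node, unsplit, if_neg fun h => (split_ne_leaf i l).1 h.1, hl, hr]

theorem split_injective (i : ℕ) : Function.Injective (split i) :=
  Function.LeftInverse.injective (unsplit_split i)

theorem eq_of_split_eq_leaf {i k : ℕ} {T : LTree} (h : T.split i = leaf k) :
    T = leaf (if k ≤ i then k else k - 1) := by
  rw [← unsplit_split i T, h]
  rfl

theorem split_unsplit_of_notMem {i : ℕ} {T : LTree} (h : i ∉ T.leaves) (h' : i + 1 ∉ T.leaves) :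
    (T.unsplit i).split i = T := by
  induction T with
  | leaf k =>
    simp only [leaves, List.mem_singleton] at h h'
    rcases lt_or_gt_of_ne (Ne.symm h) with hk | hk
    · rw [unsplit, if_pos hk.le, split_leaf_of_lt hk]
    · rw [unsplit, if_neg hk.not_ge, split_leaf_of_gt (by omega)]
      congr 1
      omega
  | node l r hl hr =>
    simp only [leaves, List.mem_append, not_or] at h h'
    rw [unsplit, if_neg, split_node, hl h.1 h'.1, hr h.2 h'.2]
    rintro ⟨rfl, _⟩
    exact h.1 (by simp [leaves])

/-- The tree contains a cherry with the leaves `i` and `i + 1`. -/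
def HasCherry (i : ℕ) : LTree → Prop
  | leaf _ => False
  | node l r => (l = leaf i ∧ r = leaf (i + 1)) ∨ l.HasCherry i ∨ r.HasCherry i

theorem HasCherry.mem_leaves {i : ℕ} {T : LTree} (h : T.HasCherry i) :
    i ∈ T.leaves ∧ i + 1 ∈ T.leaves := by
  induction T with
  | leaf k => exact h.elim
  | node l r hl hr =>
    rcases h with ⟨rfl, rfl⟩ | h | h
    · simp [leaves]
    · simp [leaves, hl h]
    · simp [leaves, hr h]

theorem split_unsplit_of_hasCherry {i : ℕ} {T : LTree} (h : T.HasCherry i) (hT : T.leaves.Nodup) :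
    (T.unsplit i).split i = T := by
  induction T with
  | leaf k => exact h.elim
  | node l r hl hr =>
    rw [leaves, List.nodup_append] at hT
    obtain ⟨hl', hr', hd⟩ := hT
    by_cases hc : l = leaf i ∧ r = leaf (i + 1)
    · rw [unsplit, if_pos hc, split_leaf_self, hc.1, hc.2]
    · rw [unsplit, if_neg hc, split_node]
      rcases h with h | h | h
      · exact absurd h hc
      · rw [hl h hl', split_unsplit_of_notMem (fun hm => hd _ h.mem_leaves.1 _ hm rfl)
          fun hm => hd _ h.mem_leaves.2 _ hm rfl]
      · rw [hr h hr', split_unsplit_of_notMem (fun hm => hd _ hm _ h.mem_leaves.1 rfl)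
          fun hm => hd _ hm _ h.mem_leaves.2 rfl]

theorem hasCherry_split {i : ℕ} {T : LTree} (h : i ∈ T.leaves) : (T.split i).HasCherry i := by
  induction T with
  | leaf k =>
    simp only [leaves, List.mem_singleton] at h
    rw [h, split_leaf_self]
    exact Or.inl ⟨rfl, rfl⟩
  | node l r hl hr =>
    simp only [leaves, List.mem_append] at h
    exact Or.inr (h.imp hl hr)

theorem HasCherry.of_split {i j : ℕ} {T : LTree} (h : (T.split i).HasCherry j) (hij : i < j) :
    i + 1 < j ∧ T.HasCherry (j - 1) := by
  induction T with
  | leaf k =>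
    rcases lt_trichotomy k i with hk | rfl | hk
    · rw [split_leaf_of_lt hk] at h
      exact h.elim
    · rw [split_leaf_self] at h
      rcases h with h | h | h
      · simp only [leaf.injEq] at h
        omega
      · exact h.elim
      · exact h.elim
    · rw [split_leaf_of_gt hk] at h
      exact h.elim
  | node l r hl hr =>
    rcases h with ⟨h, h'⟩ | h | h
    · have hne : j ≠ i + 1 := by
        rintro rfl
        exact (split_ne_leaf i l).2 h
      have hl' := eq_of_split_eq_leaf h
      have hr' := eq_of_split_eq_leaf h'
      rw [if_neg (by omega)] at hl' hr'
      exact ⟨by omega, Or.inl ⟨hl', by rw [hr']; congr 1; omega⟩⟩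
    · exact ⟨(hl h).1, Or.inr (Or.inl (hl h).2)⟩
    · exact ⟨(hr h).1, Or.inr (Or.inr (hr h).2)⟩

theorem pairwise_of_pairwise_split {i : ℕ} {T : LTree}
    (h : (T.split i).leaves.Pairwise (· < ·)) : T.leaves.Pairwise (· < ·) := by
  simp only [split, leaves_subst, List.pairwise_flatMap] at h
  refine h.2.imp fun {a b} hab => ?_
  have := hab (if a ≤ i then a else a + 1) (by split_ifs <;> simp [leaves] <;> omega)
    (if b ≤ i then b else b + 1) (by split_ifs <;> simp [leaves] <;> omega)
  split_ifs at this <;> omega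

theorem pairwise_of_pairwise_shift {i : ℕ} {T : LTree}
    (h : (T.shift i).leaves.Pairwise (· < ·)) : T.leaves.Pairwise (· < ·) := by
  simp only [shift, leaves_subst, List.pairwise_flatMap] at h
  refine h.2.imp fun {a b} hab => ?_
  have := hab (if a < i then a else a + 1) (by split_ifs <;> simp [leaves])
    (if b < i then b else b + 1) (by split_ifs <;> simp [leaves])
  split_ifs at this <;> omega

/-- A nontrivial tree whose leaves have consecutive labels contains a cherry with consecutive
labels. -/
theorem exists_hasCherry_of_isChain {T : LTree} (h : T.leaves.IsChain fun a b => b = a + 1) :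
    (∃ k, T = leaf k) ∨ ∃ i, T.HasCherry i := by
  induction T with
  | leaf k => exact Or.inl ⟨k, rfl⟩
  | node l r hl hr =>
    right
    rw [leaves] at h
    rcases hl h.left_of_append with ⟨k, rfl⟩ | ⟨i, hi⟩
    · rcases hr h.right_of_append with ⟨k', rfl⟩ | ⟨i, hi⟩
      · simp only [leaves, List.cons_append, List.nil_append, List.isChain_cons_cons] at h
        exact ⟨k, Or.inl ⟨rfl, by rw [h.1]⟩⟩
      · exact ⟨i, Or.inr (Or.inr hi)⟩
    · exact ⟨i, Or.inr (Or.inl hi)⟩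

theorem shift_shift {i j : ℕ} (h : i ≤ j) (T : LTree) :
    (T.shift j).shift i = (T.shift i).shift (j + 1) := by
  simp only [shift, subst_subst]
  refine subst_congr fun k _ => ?_
  grind [subst]

theorem split_split {i j : ℕ} (h : i < j) (T : LTree) :
    (T.split j).split i = (T.split i).split (j + 1) := by
  simp only [split, subst_subst]
  refine subst_congr fun k _ => ?_
  grind [subst]

theorem shift_split {i j : ℕ} (h : i ≤ j) (T : LTree) :
    (T.split j).shift i = (T.shift i).split (j + 1) := by
  simp only [split, shift, subst_subst]
  refine subst_congr fun k _ => ?_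
  grind [subst]

theorem split_shift {i j : ℕ} (h : i < j) (T : LTree) :
    (T.shift j).split i = (T.split i).shift (j + 1) := by
  simp only [split, shift, subst_subst]
  refine subst_congr fun k _ => ?_
  grind [subst]

end LTree

/-! ### Removing leaves and cherries from nested forests -/

namespace NestedForest

open LTree

theorem leaf_mem_iff_of_mem (F : NestedForest) {T : LTree} (hT : T ∈ F.trees) {i : ℕ}
    (hi : i ∈ T.leaves) : leaf i ∈ F.trees ↔ T = leaf i :=
  ⟨fun h => F.eq_of_mem hT h hi (by simp [leaves]), fun h => h ▸ hT⟩

/-- A set of trees is a nested forest if it becomes one after the insertion of a trivial tree. -/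
theorem exists_trees_eq_of_insert_shift (F : NestedForest) (i : ℕ) (S : Set LTree)
    (hS : F.trees = insert (leaf i) (shift i '' S)) : ∃ G : NestedForest, G.trees = S := by
  have hmem : ∀ T ∈ S, T.shift i ∈ F.trees := fun T hT => hS ▸ Or.inr ⟨T, hT, rfl⟩
  have hmem_leaves : ∀ (T : LTree) (k : ℕ),
      k ∈ T.leaves → (if k < i then k else k + 1) ∈ (T.shift i).leaves := by
    intro T k hk
    rw [mem_leaves_shift]
    split_ifs <;> first | omega | exact ⟨by omega, hk⟩
  refine ⟨⟨S, fun T hT => pairwise_of_pairwise_shift (F.sorted _ (hmem T hT)), ?_, ?_, ?_⟩, rfl⟩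
  · intro k
    obtain ⟨T', ⟨hT', hk⟩, -⟩ := F.partition (if k < i then k else k + 1)
    rw [hS] at hT'
    rcases hT' with rfl | ⟨T, hT, rfl⟩
    · simp only [leaves, List.mem_singleton] at hk
      split_ifs at hk <;> omega
    refine ⟨T, ⟨hT, ?_⟩, ?_⟩
    · rw [mem_leaves_shift] at hk
      convert hk.2 using 1
      split_ifs <;> omega
    · rintro T₁ ⟨hT₁, hk₁⟩
      exact shift_injective i (F.eq_of_mem (hmem _ hT₁) (hmem _ hT) (hmem_leaves _ _ hk₁) hk)
  · intro T hT T' hT' hne a ha b hb c hc d hd habcd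
    refine F.noncrossing _ (hmem T hT) _ (hmem T' hT') ((shift_injective i).ne hne)
      _ (hmem_leaves _ _ ha) _ (hmem_leaves _ _ hb) _ (hmem_leaves _ _ hc) _ (hmem_leaves _ _ hd) ?_
    grind
  · obtain ⟨N, hN⟩ := F.finite
    refine ⟨max N i, fun k hk => ?_⟩
    have h := hN (k + 1) (by omega)
    rw [hS] at h
    rcases h with h | ⟨T, hT, h⟩
    · simp only [leaf.injEq] at h
      omega
    · rw [eq_of_shift_eq_leaf h, if_neg (by omega)] at hT
      exact hT

/-- A set of trees is a nested forest if it becomes one after splitting a leaf. -/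
theorem exists_trees_eq_of_split (F : NestedForest) (i : ℕ) (S : Set LTree)
    (hS : F.trees = LTree.split i '' S) : ∃ G : NestedForest, G.trees = S := by
  have hmem : ∀ T ∈ S, T.split i ∈ F.trees := fun T hT => hS ▸ ⟨T, hT, rfl⟩
  have hmem_leaves : ∀ (T : LTree) (k : ℕ),
      k ∈ T.leaves → (if k ≤ i then k else k + 1) ∈ (T.split i).leaves := by
    intro T k hk
    rw [mem_leaves_split]
    split_ifs <;> first | omega | exact hk
  refine ⟨⟨S, fun T hT => pairwise_of_pairwise_split (F.sorted _ (hmem T hT)), ?_, ?_, ?_⟩, rfl⟩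
  · intro k
    obtain ⟨T', ⟨hT', hk⟩, -⟩ := F.partition (if k ≤ i then k else k + 1)
    rw [hS] at hT'
    obtain ⟨T, hT, rfl⟩ := hT'
    refine ⟨T, ⟨hT, ?_⟩, ?_⟩
    · rw [mem_leaves_split] at hk
      convert hk using 1
      split_ifs <;> omega
    · rintro T₁ ⟨hT₁, hk₁⟩
      exact split_injective i (F.eq_of_mem (hmem _ hT₁) (hmem _ hT) (hmem_leaves _ _ hk₁) hk)
  · intro T hT T' hT' hne a ha b hb c hc d hd habcd
    refine F.noncrossing _ (hmem T hT) _ (hmem T' hT') ((split_injective i).ne hne)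
      _ (hmem_leaves _ _ ha) _ (hmem_leaves _ _ hb) _ (hmem_leaves _ _ hc) _ (hmem_leaves _ _ hd) ?_
    grind
  · obtain ⟨N, hN⟩ := F.finite
    refine ⟨max N (i + 1), fun k hk => ?_⟩
    have h := hN (k + 1) (by omega)
    rw [hS] at h
    obtain ⟨T, hT, h⟩ := h
    rw [eq_of_split_eq_leaf h, if_neg (by omega)] at hT
    exact hT

theorem exists_eq_insertLeaf {F : NestedForest} {i : ℕ} (hi : leaf i ∈ F.trees) :
    ∃ G : NestedForest, F = G.insertLeaf i := by
  have hS : F.trees = insert (leaf i) (shift i '' {T | T.shift i ∈ F.trees}) := by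
    ext T
    constructor
    · intro hT
      by_cases h : i ∈ T.leaves
      · exact Or.inl ((F.leaf_mem_iff_of_mem hT h).1 hi)
      · exact Or.inr ⟨T.unshift i, by simpa [shift_unshift h] using hT, shift_unshift h⟩
    · rintro (rfl | ⟨T', hT', rfl⟩)
      · exact hi
      · exact hT'
  obtain ⟨G, hG⟩ := F.exists_trees_eq_of_insert_shift i _ hS
  exact ⟨G, NestedForest.ext (hS.trans
    (congrArg (fun S => insert (leaf i) (shift i '' S)) hG.symm))⟩

theorem exists_eq_split {F : NestedForest} {i : ℕ} {T₀ : LTree} (hT₀ : T₀ ∈ F.trees)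
    (hi : T₀.HasCherry i) : ∃ G : NestedForest, F = G.split i := by
  have key : ∀ T ∈ F.trees, (T.unsplit i).split i = T := by
    intro T hT
    by_cases h : T = T₀
    · rw [h]
      exact split_unsplit_of_hasCherry hi ((F.sorted T₀ hT₀).imp fun h => h.ne)
    · exact split_unsplit_of_notMem (fun hm => h (F.eq_of_mem hT hT₀ hm hi.mem_leaves.1))
        fun hm => h (F.eq_of_mem hT hT₀ hm hi.mem_leaves.2)
  have hS : F.trees = LTree.split i '' {T : LTree | T.split i ∈ F.trees} := by
    ext T
    constructor
    · intro hT
      exact ⟨T.unsplit i, by simpa [key T hT] using hT, key T hT⟩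
    · rintro ⟨T', hT', rfl⟩
      exact hT'
  obtain ⟨G, hG⟩ := F.exists_trees_eq_of_split i _ hS
  exact ⟨G, NestedForest.ext (hS.trans (congrArg (fun S => LTree.split i '' S) hG.symm))⟩

theorem insertLeaf_injective (i : ℕ) : Function.Injective fun F : NestedForest => F.insertLeaf i := by
  have h : ∀ F : NestedForest, leaf i ∉ shift i '' F.trees := by
    rintro F ⟨T, -, hT⟩
    have hi : i ∈ (T.shift i).leaves := by rw [hT]; simp [leaves]
    exact ((mem_leaves_shift i i T).1 hi).1 rfl
  intro F G hFG
  have hFG' : insert (leaf i) (shift i '' F.trees) = insert (leaf i) (shift i '' G.trees) :=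
    congrArg trees hFG
  refine NestedForest.ext ((shift_injective i).image_injective ?_)
  rw [← Set.insert_sdiff_self_of_notMem (h F), hFG', Set.insert_sdiff_self_of_notMem (h G)]

theorem split_injective (i : ℕ) : Function.Injective fun F : NestedForest => F.split i :=
  fun _ _ hFG => NestedForest.ext ((LTree.split_injective i).image_injective (congrArg trees hFG))

theorem leaf_mem_insertLeaf_iff {F : NestedForest} {i k : ℕ} (hik : k ≠ i) :
    leaf k ∈ (F.insertLeaf i).trees ↔ leaf (if k < i then k else k - 1) ∈ F.trees := by
  constructor
  · rintro (h | ⟨T, hT, h⟩)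
    · exact absurd (leaf.inj h) hik
    · rwa [eq_of_shift_eq_leaf h] at hT
  · intro h
    refine Or.inr ⟨_, h, ?_⟩
    split_ifs with hki
    · exact shift_leaf_of_lt hki
    · rw [shift_leaf_of_le (by omega)]
      congr 1
      omega

theorem leaf_mem_split_iff {F : NestedForest} {i k : ℕ} :
    leaf k ∈ (F.split i).trees ↔
      k ≠ i ∧ k ≠ i + 1 ∧ leaf (if k ≤ i then k else k - 1) ∈ F.trees := by
  constructor
  · rintro ⟨T, hT, h⟩
    refine ⟨?_, ?_, by rwa [eq_of_split_eq_leaf h] at hT⟩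
    · rintro rfl
      exact (split_ne_leaf k T).1 h
    · rintro rfl
      exact (split_ne_leaf i T).2 h
  · rintro ⟨h1, h2, h⟩
    refine ⟨_, h, ?_⟩
    split_ifs with hki
    · exact split_leaf_of_lt (by omega)
    · rw [split_leaf_of_gt (by omega)]
      congr 1
      omega

theorem exists_hasCherry_split (F : NestedForest) (i : ℕ) :
    ∃ T ∈ (F.split i).trees, T.HasCherry i := by
  obtain ⟨T, ⟨hT, hi⟩, -⟩ := F.partition i
  exact ⟨_, ⟨T, hT, rfl⟩, hasCherry_split hi⟩

theorem insertLeaf_insertLeaf (F : NestedForest) {i j : ℕ} (h : i ≤ j) :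
    (F.insertLeaf j).insertLeaf i = (F.insertLeaf i).insertLeaf (j + 1) := by
  refine NestedForest.ext ?_
  simp only [insertLeaf, Set.image_insert_eq, Set.image_image, shift_shift h,
    shift_leaf_of_le h, shift_leaf_of_lt (Nat.lt_succ_of_le h)]
  exact Set.insert_comm _ _ _

theorem split_split (F : NestedForest) {i j : ℕ} (h : i < j) :
    (F.split j).split i = (F.split i).split (j + 1) := by
  refine NestedForest.ext ?_
  simp only [split, Set.image_image, LTree.split_split h]

theorem insertLeaf_split (F : NestedForest) {i j : ℕ} (h : i ≤ j) :
    (F.split j).insertLeaf i = (F.insertLeaf i).split (j + 1) := by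
  refine NestedForest.ext ?_
  simp only [split, insertLeaf, Set.image_insert_eq, Set.image_image, shift_split h,
    split_leaf_of_lt (Nat.lt_succ_of_le h)]

theorem split_insertLeaf (F : NestedForest) {i j : ℕ} (h : i < j) :
    (F.insertLeaf j).split i = (F.split i).insertLeaf (j + 1) := by
  refine NestedForest.ext ?_
  simp only [split, insertLeaf, Set.image_insert_eq, Set.image_image, split_shift h,
    split_leaf_of_gt h]

theorem SupportedOn.insertLeaf {F : NestedForest} {n i : ℕ} (hF : F.SupportedOn n) (hi : i ≤ n) :
    (F.insertLeaf i).SupportedOn (n + 1) := by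
  intro k hk
  rw [leaf_mem_insertLeaf_iff (by omega), if_neg (by omega)]
  exact hF _ (by omega)

theorem SupportedOn.split {F : NestedForest} {n i : ℕ} (hF : F.SupportedOn n) (hi : i < n) :
    (F.split i).SupportedOn (n + 1) := by
  intro k hk
  rw [leaf_mem_split_iff, if_neg (by omega)]
  exact ⟨by omega, by omega, hF _ (by omega)⟩

theorem SupportedOn.of_insertLeaf {F : NestedForest} {n i : ℕ}
    (hF : (F.insertLeaf i).SupportedOn (n + 1)) (hi : i ≤ n) : F.SupportedOn n := by
  intro k hk
  have h := hF (k + 1) (by omega)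
  rwa [leaf_mem_insertLeaf_iff (by omega), if_neg (by omega)] at h

theorem SupportedOn.of_split {F : NestedForest} {n i : ℕ}
    (hF : (F.split i).SupportedOn (n + 1)) (hi : i < n) : F.SupportedOn n := by
  intro k hk
  have h := hF (k + 1) (by omega)
  rw [leaf_mem_split_iff, if_neg (by omega)] at h
  exact h.2.2

theorem SupportedOn.eq_empty {F : NestedForest} (hF : F.SupportedOn 0) : F = empty := by
  refine NestedForest.ext (Set.ext fun T => ⟨fun hT => ?_, ?_⟩)
  · obtain ⟨k, hk⟩ := T.exists_mem_leaves
    exact ⟨k, ((F.leaf_mem_iff_of_mem hT hk).1 (hF k k.zero_le)).symm⟩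
  · rintro ⟨k, rfl⟩
    exact hF k k.zero_le

/-- Among the trees of a forest whose leaves have labels in an interval and which are not trivial, a
tree of minimal width has consecutive leaves: a missing label would belong to a tree of smaller
width, as the forest is noncrossing. -/
theorem exists_isChain {F : NestedForest} {n : ℕ} (hF : F.SupportedOn (n + 1))
    (hn : ∀ i ≤ n, leaf i ∉ F.trees) (d : ℕ) : ∀ T ∈ F.trees, (∀ k, T ≠ leaf k) → ∀ a,
      (∀ k ∈ T.leaves, a ≤ k ∧ k ≤ a + d) →
      ∃ T ∈ F.trees, (∀ k, T ≠ leaf k) ∧ T.leaves.IsChain fun a b => b = a + 1 := by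
  induction d using Nat.strong_induction_on with
  | _ d ih =>
    intro T hT hleaf a ha
    by_cases hch : T.leaves.IsChain fun a b => b = a + 1
    · exact ⟨T, hT, hleaf, hch⟩
    rw [List.isChain_iff_getElem] at hch
    push Not at hch
    obtain ⟨m, hm, hne⟩ := hch
    have hs := List.pairwise_iff_getElem.1 (F.sorted T hT)
    set x := T.leaves[m] with hx
    set y := T.leaves[m + 1] with hy
    have hxy : x < y := hs m (m + 1) (by omega) hm (by omega)
    have hxT : x ∈ T.leaves := List.getElem_mem _
    have hyT : y ∈ T.leaves := List.getElem_mem _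
    have hyn : y ≤ n := by
      by_contra hy'
      exact hleaf y ((F.leaf_mem_iff_of_mem hT hyT).1 (hF y (by omega)))
    have hx1 : x + 1 ∉ T.leaves := by
      intro hmem
      obtain ⟨p, hp, hpx⟩ := List.getElem_of_mem hmem
      rcases lt_trichotomy p m with h | h | h
      · have := hs p m hp (by omega) h
        omega
      · subst h
        omega
      · rcases (Nat.succ_le_of_lt h).eq_or_lt with h | h
        · subst h
          simp only [Nat.succ_eq_add_one] at hpx
          omega
        · have := hs (m + 1) p hm hp h
          omega
    obtain ⟨T', ⟨hT', hxT'⟩, -⟩ := F.partition (x + 1)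
    have hTT' : T ≠ T' := fun h => hx1 (h ▸ hxT')
    have hdisj : ∀ k ∈ T'.leaves, k ∉ T.leaves := fun k hk hk' =>
      hTT' (F.eq_of_mem hT hT' hk' hk)
    have hbd : ∀ k ∈ T'.leaves, x + 1 ≤ k ∧ k ≤ x + 1 + (y - x - 2) := by
      intro k hk
      have h1 : k ≠ x := fun h => hdisj k hk (h ▸ hxT)
      have h2 : k ≠ y := fun h => hdisj k hk (h ▸ hyT)
      have h3 := F.noncrossing T hT T' hT' hTT' x hxT y hyT (x + 1) hxT' k hk
      have h4 := F.noncrossing T' hT' T hT hTT'.symm k hk (x + 1) hxT' x hxT y hyT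
      omega
    refine ih (y - x - 2) ?_ T' hT' ?_ (x + 1) hbd
    · have := ha x hxT
      have := ha y hyT
      omega
    · rintro k rfl
      simp only [leaves, List.mem_singleton] at hxT'
      exact hn k (by omega) hT'

/-- A forest in which no leaf up to `n` is trivial contains a cherry with consecutive labels. -/
theorem exists_hasCherry {F : NestedForest} {n : ℕ} (hF : F.SupportedOn (n + 1))
    (hn : ∀ i ≤ n, leaf i ∉ F.trees) : ∃ i < n, ∃ T ∈ F.trees, T.HasCherry i := by
  obtain ⟨T₀, ⟨hT₀, h0⟩, -⟩ := F.partition 0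
  have hb : ∀ (T : LTree), T ∈ F.trees → (∀ k, T ≠ leaf k) → ∀ k ∈ T.leaves, k ≤ n := by
    intro T hT hne k hk
    by_contra hk'
    exact hne k ((F.leaf_mem_iff_of_mem hT hk).1 (hF k (by omega)))
  have hne : ∀ k, T₀ ≠ leaf k := by
    rintro k rfl
    simp only [leaves, List.mem_singleton] at h0
    exact hn k (by omega) hT₀
  obtain ⟨T, hT, hleaf, hch⟩ := exists_isChain hF hn n T₀ hT₀ hne 0
    fun k hk => ⟨k.zero_le, by simpa using hb T₀ hT₀ hne k hk⟩
  rcases exists_hasCherry_of_isChain hch with ⟨k, hk⟩ | ⟨i, hi⟩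
  · exact absurd hk (hleaf k)
  · exact ⟨i, hb T hT hleaf _ hi.mem_leaves.2, T, hT, hi⟩

end NestedForest

theorem RTSeq.supportedOn_forest : {n : ℕ} → (Ω : RTSeq n) → Ω.forest.SupportedOn n
  | _, .nil => fun i _ => ⟨i, rfl⟩
  | _, .r Ω j => Ω.supportedOn_forest.insertLeaf (Nat.le_of_lt_succ j.2)
  | _, .t Ω j => Ω.supportedOn_forest.split j.2

theorem trim_nonempty (n : ℕ) (F : NestedForest) (hF : F.SupportedOn n) : (Trim n F).Nonempty := by
  induction n generalizing F with
  | zero => exact ⟨.nil, hF.eq_empty.symm⟩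
  | succ n ih =>
    by_cases h : ∃ i ≤ n, LTree.leaf i ∈ F.trees
    · obtain ⟨i, hi, hiF⟩ := h
      obtain ⟨G, rfl⟩ := NestedForest.exists_eq_insertLeaf hiF
      obtain ⟨Ω, hΩ⟩ := ih G (hF.of_insertLeaf hi)
      exact ⟨Ω.r ⟨i, Nat.lt_succ_of_le hi⟩, congrArg (fun G : NestedForest => G.insertLeaf i)
        (show Ω.forest = G from hΩ)⟩
    · push Not at h
      obtain ⟨i, hi, T, hT, hTi⟩ := NestedForest.exists_hasCherry hF h
      obtain ⟨G, rfl⟩ := NestedForest.exists_eq_split hT hTi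
      obtain ⟨Ω, hΩ⟩ := ih G (hF.of_split hi)
      exact ⟨Ω.t ⟨i, hi⟩, congrArg (fun G : NestedForest => G.split i)
        (show Ω.forest = G from hΩ)⟩

/-! ### Independence of the sequence -/

theorem above_trans_above {n : ℕ} {i j : Fin (n + 2)} {i' j' : Fin (n + 1)} (hi : i.val = i'.val)
    (hj : j.val = j'.val + 1) (hij : i'.val ≤ j'.val) :
    (above j').trans (above i) = (above i').trans (above j) := by
  ext a
  change (i.succAbove (j'.succAbove a)).val = (j.succAbove (i'.succAbove a)).val
  simp only [val_succAbove]
  split_ifs <;> omega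

theorem pair_trans_above {n : ℕ} {i : Fin (n + 1)} {i' : Fin n} {j : Fin (n + 2)}
    (h : i.val = i'.val ∧ i'.val + 1 < j.val ∨ i.val = i'.val + 1 ∧ j.val ≤ i'.val) :
    (pair i').trans (above j) = pair i := by
  ext a
  change (j.succAbove (pair i' a)).val = (pair i a).val
  rw [val_succAbove]
  fin_cases a
  · change (if i'.val < j.val then i'.val else i'.val + 1) = i.val
    split_ifs <;> omega
  · change (if i'.val + 1 < j.val then i'.val + 1 else i'.val + 1 + 1) = i.val + 1
    split_ifs <;> omega

theorem extend_borel_extend_borel {n : ℕ} {i j : Fin (n + 2)} {i' j' : Fin (n + 1)}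
    (hi : i.val = i'.val) (hj : j.val = j'.val + 1) (hij : i'.val ≤ j'.val)
    (S : Set (GL (Fin n) ℂ)) :
    extend i (borel _) (extend j' (borel _) S) = extend j (borel _) (extend i' (borel _) S) :=
  extend_extend_eq (isBlockExt_borel ⟨Fin.elim0, fun a => a.elim0⟩)
    (isBlockExt_borel ⟨Fin.elim0, fun a => a.elim0⟩) (isBlockExt_borel _) (isBlockExt_borel _)
    (fun a => a.elim0) (above_trans_above hi hj hij) S

theorem extend_borel_extend_parab {n : ℕ} {i : Fin (n + 2)} {i' : Fin (n + 1)} {j : Fin (n + 1)}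
    {j' : Fin n}
    (h : i.val = i'.val ∧ j.val = j'.val + 1 ∧ i'.val ≤ j'.val ∨
      i.val = i'.val + 1 ∧ j.val = j'.val ∧ j'.val < i'.val) (S : Set (GL (Fin n) ℂ)) :
    extend i (borel _) (extend j'.castSucc (parab j') S) =
      extend j.castSucc (parab j) (extend i' (borel _) S) := by
  refine extend_extend_eq (isBlockExt_borel ⟨Fin.elim0, fun a => a.elim0⟩) (isBlockExt_parab j')
    (isBlockExt_borel _) ?_ (fun a => a.elim0) ?_ S
  · rw [pair_trans_above (i := j) (by omega)]
    exact isBlockExt_parab j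
  · rcases h with h | h
    · exact above_trans_above h.1 (by simpa using h.2.1) (by simpa using h.2.2)
    · exact (above_trans_above (by simpa using h.2.1) h.1 (by simpa using h.2.2.le)).symm

theorem extend_parab_extend_parab {n : ℕ} {i j : Fin (n + 1)} {i' j' : Fin n}
    (hi : i.val = i'.val) (hj : j.val = j'.val + 1) (hij : i'.val < j'.val)
    (S : Set (GL (Fin n) ℂ)) :
    extend i.castSucc (parab i) (extend j'.castSucc (parab j') S) =
      extend j.castSucc (parab j) (extend i'.castSucc (parab i') S) := by
  have h1 : (pair i').trans (above j.castSucc) = pair i :=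
    pair_trans_above (Or.inl ⟨hi, by simp; omega⟩)
  have h2 : (pair j').trans (above i.castSucc) = pair j :=
    pair_trans_above (Or.inr ⟨hj, by simp; omega⟩)
  refine extend_extend_eq (isBlockExt_parab i') (isBlockExt_parab j') ?_ ?_ ?_
    (above_trans_above (by simpa using hi) (by simpa using hj) (by simpa using hij.le)) S
  · rw [h1]
    exact isBlockExt_parab i
  · rw [h2]
    exact isBlockExt_parab j
  · intro a b
    change (pair i').trans (above j.castSucc) a ≠ (pair j').trans (above i.castSucc) b
    rw [h1, h2]
    fin_cases a <;> fin_cases b <;> simp [Fin.ext_iff] <;> omega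

namespace RTSeq

/-- The translates of all sequences of length `n` with the same forest agree. -/
def TranslateEq (n : ℕ) : Prop :=
  ∀ Ω Ω' : RTSeq n, Ω.forest = Ω'.forest → Ω.translate = Ω'.translate

/-- If the last letters remove two trivial trees, the removals commute: both sequences are compared
with sequences which end with both letters, in the two orders. -/
theorem translate_r_eq_translate_r {n : ℕ} (ih : TranslateEq n) {Ω Ω' : RTSeq n}
    {i j : Fin (n + 1)} (hij : i < j) (h : (Ω.r i).forest = (Ω'.r j).forest) :
    (Ω.r i).translate = (Ω'.r j).translate := by
  obtain _ | n := n
  · omega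
  obtain ⟨j', hj⟩ : ∃ j' : Fin (n + 1), j.val = j'.val + 1 := ⟨⟨j.val - 1, by omega⟩, by simp; omega⟩
  obtain ⟨i', hi⟩ : ∃ i' : Fin (n + 1), i.val = i'.val := ⟨⟨i.val, by omega⟩, rfl⟩
  have hij' : i'.val ≤ j'.val := by omega
  change Ω.forest.insertLeaf i.val = Ω'.forest.insertLeaf j.val at h
  have hleaf : LTree.leaf j.val ∈ (Ω.forest.insertLeaf i.val).trees := by
    rw [h]
    exact Or.inl rfl
  rw [NestedForest.leaf_mem_insertLeaf_iff (by omega), if_neg (by omega), hj,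
    Nat.add_sub_cancel] at hleaf
  obtain ⟨G, hG⟩ := NestedForest.exists_eq_insertLeaf hleaf
  rw [hG, hi, hj, G.insertLeaf_insertLeaf hij'] at h
  have hG' := NestedForest.insertLeaf_injective _ h
  have hsupp := Ω.supportedOn_forest
  rw [hG] at hsupp
  obtain ⟨Ω₀, hΩ₀⟩ := trim_nonempty n G (hsupp.of_insertLeaf (by omega))
  have hΩ₀' : Ω₀.forest = G := hΩ₀
  rw [translate_r, translate_r, ih Ω (Ω₀.r j') (by rw [hG, forest, hΩ₀']),
    ih Ω' (Ω₀.r i') (by rw [← hG', forest, hΩ₀']), translate_r, translate_r]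
  exact extend_borel_extend_borel hi hj hij' _

/-- The analogue of `translate_r_eq_translate_r` for two cherries, which are disjoint. -/
theorem translate_t_eq_translate_t {n : ℕ} (ih : TranslateEq n) {Ω Ω' : RTSeq n}
    {i j : Fin n} (hij : i < j) (h : (Ω.t i).forest = (Ω'.t j).forest) :
    (Ω.t i).translate = (Ω'.t j).translate := by
  obtain _ | n := n
  · exact i.elim0
  change Ω.forest.split i.val = Ω'.forest.split j.val at h
  obtain ⟨T, hT, hTj⟩ := Ω'.forest.exists_hasCherry_split j.val
  rw [← h] at hT
  obtain ⟨T, hT, rfl⟩ := hT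
  obtain ⟨hij1, hTj'⟩ := hTj.of_split hij
  obtain ⟨j', hj⟩ : ∃ j' : Fin n, j.val = j'.val + 1 := ⟨⟨j.val - 1, by omega⟩, by simp; omega⟩
  obtain ⟨i', hi⟩ : ∃ i' : Fin n, i.val = i'.val := ⟨⟨i.val, by omega⟩, rfl⟩
  have hij' : i'.val < j'.val := by omega
  rw [hj, Nat.add_sub_cancel] at hTj'
  obtain ⟨G, hG⟩ := NestedForest.exists_eq_split hT hTj'
  rw [hG, hi, hj, G.split_split hij'] at h
  have hG' := NestedForest.split_injective _ h
  have hsupp := Ω.supportedOn_forest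
  rw [hG] at hsupp
  obtain ⟨Ω₀, hΩ₀⟩ := trim_nonempty n G (hsupp.of_split j'.2)
  have hΩ₀' : Ω₀.forest = G := hΩ₀
  rw [translate_t, translate_t, ih Ω (Ω₀.t j') (by rw [hG, forest, hΩ₀']),
    ih Ω' (Ω₀.t i') (by rw [← hG', forest, hΩ₀']), translate_t, translate_t]
  exact extend_parab_extend_parab hi hj hij' _

/-- The analogue of `translate_r_eq_translate_r` for a trivial tree and a cherry. The trivial tree
lies on either side of the cherry. -/
theorem translate_r_eq_translate_t {n : ℕ} (ih : TranslateEq n) {Ω Ω' : RTSeq n}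
    {i : Fin (n + 1)} {j : Fin n} (h : (Ω.r i).forest = (Ω'.t j).forest) :
    (Ω.r i).translate = (Ω'.t j).translate := by
  obtain _ | n := n
  · exact j.elim0
  change Ω.forest.insertLeaf i.val = Ω'.forest.split j.val at h
  have hleaf : LTree.leaf i.val ∈ (Ω'.forest.split j.val).trees := by
    rw [← h]
    exact Or.inl rfl
  rw [NestedForest.leaf_mem_split_iff] at hleaf
  obtain ⟨hij, hij1, hleaf⟩ := hleaf
  have main : ∀ (i' : Fin (n + 1)) (j' : Fin n), LTree.leaf i'.val ∈ Ω'.forest.trees →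
      (i.val = i'.val ∧ j.val = j'.val + 1 ∧ i'.val ≤ j'.val ∨
        i.val = i'.val + 1 ∧ j.val = j'.val ∧ j'.val < i'.val) →
      (Ω.r i).translate = (Ω'.t j).translate := by
    intro i' j' hi' hc
    obtain ⟨G, hG⟩ := NestedForest.exists_eq_insertLeaf hi'
    have hG' : Ω.forest = G.split j'.val := by
      refine NestedForest.insertLeaf_injective i.val (h.trans ?_)
      rcases hc with ⟨hi, hj, hle⟩ | ⟨hi, hj, hlt⟩
      · rw [hG, hi, hj]
        exact (G.insertLeaf_split hle).symm
      · rw [hG, hi, hj]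
        exact G.split_insertLeaf hlt
    have hsupp := Ω'.supportedOn_forest
    rw [hG] at hsupp
    obtain ⟨Ω₀, hΩ₀⟩ := trim_nonempty n G (hsupp.of_insertLeaf (by omega))
    have hΩ₀' : Ω₀.forest = G := hΩ₀
    rw [translate_r, translate_t, ih Ω (Ω₀.t j') (by rw [hG', forest, hΩ₀']),
      ih Ω' (Ω₀.r i') (by rw [hG, forest, hΩ₀']), translate_r, translate_t]
    exact extend_borel_extend_parab hc _
  by_cases hlt : i.val ≤ j.val
  · rw [if_pos hlt] at hleaf
    refine main ⟨i.val, by omega⟩ ⟨j.val - 1, by omega⟩ hleaf (Or.inl ⟨rfl, ?_, ?_⟩) <;> simp <;>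
      omega
  · rw [if_neg hlt] at hleaf
    refine main ⟨i.val - 1, by omega⟩ ⟨j.val, by omega⟩ hleaf (Or.inr ⟨?_, rfl, ?_⟩) <;> simp <;>
      omega

/-- The translate `u(Ω)⁻¹ X(Ω)` only depends on the forest of `Ω`. -/
theorem translateEq (n : ℕ) : TranslateEq n := by
  induction n with
  | zero =>
    intro Ω Ω' _
    cases Ω
    cases Ω'
    rfl
  | succ n ih =>
    intro Ω Ω' h
    cases Ω with
    | r Ω i =>
      cases Ω' with
      | r Ω' j =>
        rcases lt_trichotomy i j with hij | rfl | hij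
        · exact translate_r_eq_translate_r ih hij h
        · rw [translate_r, translate_r, ih _ _ (NestedForest.insertLeaf_injective _ h)]
        · exact (translate_r_eq_translate_r ih hij h.symm).symm
      | t Ω' j => exact translate_r_eq_translate_t ih h
    | t Ω i =>
      cases Ω' with
      | r Ω' j => exact (translate_r_eq_translate_t ih h.symm).symm
      | t Ω' j =>
        rcases lt_trichotomy i j with hij | rfl | hij
        · exact translate_t_eq_translate_t ih hij h
        · rw [translate_t, translate_t, ih _ _ (NestedForest.split_injective _ h)]
        · exact (translate_t_eq_translate_t ih hij h.symm).symm

end RTSeq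

end QSymSchubert

open QSymSchubert
theorem mainTheorem10 (n : ℕ) (F : NestedForest) (hF : F.SupportedOn n) :
    (Trim n F).Nonempty ∧
    (∀ Ω ∈ Trim n F, ∀ Ω' ∈ Trim n F, (permGL Ω.u)⁻¹ • Ω.X = (permGL Ω'.u)⁻¹ • Ω'.X) ∧
    ∃ XF : Set (FlagVar n), IsClosed XF ∧
      (∀ Y : Set (FlagVar n), (∀ Ω ∈ Trim n F, Y = (permGL Ω.u)⁻¹ • Ω.X) ↔ Y = XF) ∧
      ∀ Ω ∈ Trim n F, ∃ e : Ω.X ≃ XF, IsVarietyIso e ∧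
        ∀ x : Ω.X, (e x : FlagVar n) = (permGL Ω.u)⁻¹ • (x : FlagVar n) := by
  have hne := trim_nonempty n F hF
  have heq : ∀ Ω ∈ Trim n F, ∀ Ω' ∈ Trim n F,
      (permGL Ω.u)⁻¹ • Ω.X = (permGL Ω'.u)⁻¹ • Ω'.X := fun Ω hΩ Ω' hΩ' =>
    RTSeq.smul_X_eq_of_translate_eq (RTSeq.translateEq n Ω Ω' (Eq.trans hΩ (Eq.symm hΩ')))
  obtain ⟨Ω₀, hΩ₀⟩ := hne
  refine ⟨⟨Ω₀, hΩ₀⟩, heq, (permGL Ω₀.u)⁻¹ • Ω₀.X, Ω₀.isClosed_smul_X _, fun Y => ⟨fun h => h Ω₀ hΩ₀,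
    fun h Ω hΩ => h.trans (heq _ hΩ₀ _ hΩ)⟩, fun Ω hΩ => Ω.exists_isVarietyIso _ (heq _ hΩ₀ _ hΩ)⟩
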